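/- Let $k$ be a field. A dual quasi-bialgebra over $k$ is a coassociative counital coalgebra $(A,\Delta,\varepsilon)$ with coalgebra morphisms $A\otimes A\to A$, $a\otimes b\mapsto ab$, and $u:k\to A$, $u(1)=1$, and an element $\varphi\in(A\otimes A\otimes A)^*$ that is invertible for the convolution product, such that for all $a,b,c,d\in A$ (Sweedler notation) $$\sum a_1(b_1c_1)\,\varphi(a_2,b_2,c_2)=\sum\varphi(a_1,b_1,c_1)\,(a_2b_2)c_2,\qquad 1a=a1=a,$$ $$\sum\varphi(a_1,b_1,c_1d_1)\,\varphi(a_2b_2,c_2,d_2)=\sum\varphi(b_1,c_1,d_1)\,\varphi(a_1,b_2c_2,d_2)\,\varphi(a_2,b_3,c_3),\qquad \varphi(a,1,b)=\varepsilon(a)\varepsilon(b).$$ A dual quasi-Hopf algebra is a dual quasi-bialgebra together with a coalgebra antimorphism $S:A\to A$ (not assumed bijective) and functionals $\alpha,\beta\in A^*$ such that for all $a\in A$ $$\sum S(a_1)\alpha(a_2)a_3=\alpha(a)1,\qquad \sum a_1\beta(a_2)S(a_3)=\beta(a)1,$$ $$\sum\varphi\bigl(a_1\beta(a_2),S(a_3),\alpha(a_4)a_5\bigr)=\sum\varphi^{-1}\bigl(S(a_1),\alpha(a_2)a_3,\beta(a_4)S(a_5)\bigr)=\varepsilon(a).$$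 A left (respectively right) integral on $A$ is a functional $T\in A^*$ with $fT=f(1)T$ (respectively $Tf=f(1)T$) for all $f\in A^*$, where $A^*$ carries the convolution product $(fg)(a)=\sum f(a_1)g(a_2)$. A dual quasi-Hopf subalgebra of $A$ is a subcoalgebra $B\subseteq A$ that is closed under the multiplication of $A$, contains $1$ and satisfies $S(B)\subseteq B$; it is a dual quasi-Hopf algebra with the restricted structure. **Corollary 4.6.** Let $A$ be a dual quasi-Hopf algebra that has a non-zero left integral or a non-zero right integral. Then every dual quasi-Hopf subalgebra $B$ of $A$ has both a non-zero left integral and a non-zero right integral. -/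

import Mathlib

open TensorProduct WithConv

noncomputable section

namespace DualQuasi

universe u v w

section Actions

variable {k : Type u} {C : Type v} [Field k] [AddCommGroup C] [Module k C] [Coalgebra k C]

/-- The left action of `C^*` on `C`: `f ⇀ c = ∑ f(c₂) c₁`. -/
def leftHit (f : Module.Dual k C) : C →ₗ[k] C :=
  (TensorProduct.rid k C).toLinearMap ∘ₗ f.lTensor C ∘ₗ Coalgebra.comul

/-- The right action of `C^*` on `C`: `c ↼ f = ∑ f(c₁) c₂`. -/
def rightHit (f : Module.Dual k C) : C →ₗ[k] C :=
  (TensorProduct.lid k C).toLinearMap ∘ₗ f.rTensor C ∘ₗ Coalgebra.comul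

variable (k C) in
/-- The iterated comultiplication `c ↦ ∑ c₁ ⊗ (c₂ ⊗ c₃)`. -/
def comul₃ : C →ₗ[k] C ⊗[k] (C ⊗[k] C) :=
  (Coalgebra.comul (R := k) (A := C)).lTensor C ∘ₗ Coalgebra.comul

end Actions

/-- A dual quasi-bialgebra structure on a coalgebra `A` over a field `k`. The dual `C^*` of a
coalgebra `C` (here `C = A ⊗ A ⊗ A` and `C = A ⊗ A ⊗ A ⊗ A`) carries the convolution product
`(f * g)(c) = ∑ f(c₁) g(c₂)`, with unit the counit. -/
structure DualQuasiBialgebra (k : Type u) (A : Type v) [Field k] [AddCommGroup A] [Module k A]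
    [Coalgebra k A] where
  /-- the multiplication, a morphism of coalgebras -/
  M : A ⊗[k] A →ₗc[k] A
  /-- the unit map, a morphism of coalgebras -/
  u : k →ₗc[k] A
  /-- the reassociator -/
  φ : Module.Dual k (A ⊗[k] (A ⊗[k] A))
  /-- the convolution inverse of the reassociator -/
  φInv : Module.Dual k (A ⊗[k] (A ⊗[k] A))
  φ_mul_φInv : toConv φ * toConv φInv = 1
  φInv_mul_φ : toConv φInv * toConv φ = 1
  /-- `∑ a₁(b₁c₁) φ(a₂, b₂, c₂) = ∑ φ(a₁, b₁, c₁) (a₂b₂)c₂` -/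
  quasi_assoc :
    (TensorProduct.rid k A).toLinearMap ∘ₗ
        TensorProduct.map (M.toLinearMap ∘ₗ M.toLinearMap.lTensor A) φ ∘ₗ Coalgebra.comul =
      (TensorProduct.lid k A).toLinearMap ∘ₗ
        TensorProduct.map φ (M.toLinearMap ∘ₗ M.toLinearMap.rTensor A ∘ₗ
          (TensorProduct.assoc k A A A).symm.toLinearMap) ∘ₗ Coalgebra.comul
  one_mul : ∀ a : A, M (u 1 ⊗ₜ[k] a) = a
  mul_one : ∀ a : A, M (a ⊗ₜ[k] u 1) = a
  /-- `∑ φ(a₁, b₁, c₁d₁) φ(a₂b₂, c₂, d₂) = ∑ φ(b₁, c₁, d₁) φ(a₁, b₂c₂, d₂) φ(a₂, b₃, c₃)` -/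
  cocycle :
    toConv (φ ∘ₗ (M.toLinearMap.lTensor A).lTensor A) *
        toConv (φ ∘ₗ M.toLinearMap.rTensor (A ⊗[k] A) ∘ₗ
          (TensorProduct.assoc k A A (A ⊗[k] A)).symm.toLinearMap) =
      toConv (φ ∘ₗ (TensorProduct.lid k (A ⊗[k] (A ⊗[k] A))).toLinearMap ∘ₗ
          (Coalgebra.counit (R := k) (A := A)).rTensor (A ⊗[k] (A ⊗[k] A))) *
        toConv (φ ∘ₗ (M.toLinearMap.rTensor A ∘ₗ
          (TensorProduct.assoc k A A A).symm.toLinearMap).lTensor A) *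
        toConv (φ ∘ₗ (((TensorProduct.rid k A).toLinearMap ∘ₗ
          (Coalgebra.counit (R := k) (A := A)).lTensor A).lTensor A).lTensor A)
  φ_one : ∀ a b : A, φ (a ⊗ₜ[k] (u 1 ⊗ₜ[k] b)) =
    Coalgebra.counit (R := k) a * Coalgebra.counit (R := k) b

/-- A dual quasi-Hopf algebra structure on a coalgebra `A`: a dual quasi-bialgebra with an
antimorphism of coalgebras `S` (not assumed bijective) and functionals `α`, `β`. Note that
`c ↼ α = ∑ α(c₁) c₂`, `β ⇀ c = ∑ c₁ β(c₂)` and `S (c ↼ β) = ∑ β(c₁) S(c₂)`. -/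
structure DualQuasiHopfAlgebra (k : Type u) (A : Type v) [Field k] [AddCommGroup A] [Module k A]
    [Coalgebra k A] extends DualQuasiBialgebra k A where
  /-- the antipode -/
  S : A →ₗ[k] A
  counit_S : Coalgebra.counit (R := k) ∘ₗ S = Coalgebra.counit
  /-- `Δ(S(a)) = ∑ S(a₂) ⊗ S(a₁)` -/
  comul_S : Coalgebra.comul (R := k) ∘ₗ S =
    (TensorProduct.comm k A A).toLinearMap ∘ₗ TensorProduct.map S S ∘ₗ Coalgebra.comul
  α : Module.Dual k A
  β : Module.Dual k A
  /-- `∑ S(a₁) α(a₂) a₃ = α(a) 1` -/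
  antipode_α : ∀ a : A,
    M (TensorProduct.map S (rightHit α) (Coalgebra.comul (R := k) a)) = α a • u 1
  /-- `∑ a₁ β(a₂) S(a₃) = β(a) 1` -/
  antipode_β : ∀ a : A,
    M (TensorProduct.map (leftHit β) S (Coalgebra.comul (R := k) a)) = β a • u 1
  /-- `∑ φ(a₁ β(a₂), S(a₃), α(a₄) a₅) = ε(a)` -/
  antipode_φ : ∀ a : A,
    φ (TensorProduct.map (leftHit β) (TensorProduct.map S (rightHit α)) (comul₃ k A a)) =
      Coalgebra.counit (R := k) a
  /-- `∑ φ⁻¹(S(a₁), α(a₂) a₃, β(a₄) S(a₅)) = ε(a)` -/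
  antipode_φInv : ∀ a : A,
    φInv (TensorProduct.map S (TensorProduct.map (rightHit α) (S ∘ₗ rightHit β)) (comul₃ k A a)) =
      Coalgebra.counit (R := k) a

section Integrals

variable {k : Type u} {A : Type v} [Field k] [AddCommGroup A] [Module k A] [Coalgebra k A]

/-- The space of left integrals on `A`: all `T ∈ A^*` with `f T = f(1) T` for all `f ∈ A^*`,
the product being convolution. -/
def DualQuasiBialgebra.leftIntegrals (H : DualQuasiBialgebra k A) :
    Submodule k (Module.Dual k A) where
  carrier := {T | ∀ f : Module.Dual k A, toConv f * toConv T = f (H.u 1) • toConv T}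
  zero_mem' f := by simp
  add_mem' {S T} hS hT f := by
    rw [toConv_add, mul_add, smul_add, hS f, hT f]
  smul_mem' c T hT f := by
    rw [toConv_smul, mul_smul_comm, hT f, smul_comm]

/-- The space of right integrals on `A`: all `T ∈ A^*` with `T f = f(1) T` for all `f ∈ A^*`.
These are the left integrals on `A` with the opposite multiplication and comultiplication: the
latter reverses the convolution product of `A^*`, and the unit `1` is unchanged. -/
def DualQuasiBialgebra.rightIntegrals (H : DualQuasiBialgebra k A) :
    Submodule k (Module.Dual k A) where
  carrier := {T | ∀ f : Module.Dual k A, toConv T * toConv f = f (H.u 1) • toConv T}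
  zero_mem' f := by simp
  add_mem' {S T} hS hT f := by
    rw [toConv_add, add_mul, smul_add, hS f, hT f]
  smul_mem' c T hT f := by
    rw [toConv_smul, smul_mul_assoc, hT f, smul_comm]

end Integrals

section Restriction

variable {k : Type u} {A : Type v} {B : Type w} [Field k]
  [AddCommGroup A] [Module k A] [AddCommGroup B] [Module k B]

theorem map_injective {C : Type*} {D : Type*} [AddCommGroup C] [Module k C] [AddCommGroup D]
    [Module k D] (f : B →ₗ[k] A) (g : C →ₗ[k] D) (hf : Function.Injective f)
    (hg : Function.Injective g) : Function.Injective (TensorProduct.map f g) :=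
  TensorProduct.map_injective_of_flat_flat f g hf hg

theorem rid_map_comp {C : Type*} {D : Type*} [AddCommGroup C] [Module k C]
    [AddCommGroup D] [Module k D] (ι : B →ₗ[k] A) (j : C →ₗ[k] D)
    (p : C →ₗ[k] B) (P : D →ₗ[k] A) (q : Module.Dual k D) (h : ∀ c, ι (p c) = P (j c))
    (y : C ⊗[k] C) :
    ι (TensorProduct.rid k B (TensorProduct.map p (q ∘ₗ j) y)) =
      TensorProduct.rid k A (TensorProduct.map P q (TensorProduct.map j j y)) := by
  induction y with
  | zero => simp
  | add x y hx hy => simp only [map_add, hx, hy]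
  | tmul x y => simp [h]

theorem lid_map_comp {C : Type*} {D : Type*} [AddCommGroup C] [Module k C]
    [AddCommGroup D] [Module k D] (ι : B →ₗ[k] A) (j : C →ₗ[k] D)
    (p : C →ₗ[k] B) (P : D →ₗ[k] A) (q : Module.Dual k D) (h : ∀ c, ι (p c) = P (j c))
    (y : C ⊗[k] C) :
    ι (TensorProduct.lid k B (TensorProduct.map (q ∘ₗ j) p y)) =
      TensorProduct.lid k A (TensorProduct.map q P (TensorProduct.map j j y)) := by
  induction y with
  | zero => simp
  | add x y hx hy => simp only [map_add, hx, hy]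
  | tmul x y => simp [h]

theorem map_map_of_comm {C : Type*} {D : Type*} {C' : Type*} {D' : Type*}
    [AddCommGroup C] [Module k C] [AddCommGroup D] [Module k D]
    [AddCommGroup C'] [Module k C'] [AddCommGroup D'] [Module k D']
    (ι : B →ₗ[k] A) (j : C →ₗ[k] D) (ι' : B →ₗ[k] A) (j' : C' →ₗ[k] D')
    (p : B →ₗ[k] B) (P : A →ₗ[k] A) (q : C →ₗ[k] C') (Q : D →ₗ[k] D')
    (h₁ : ∀ x, ι' (p x) = P (ι x)) (h₂ : ∀ x, j' (q x) = Q (j x)) (y : B ⊗[k] C) :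
    TensorProduct.map ι' j' (TensorProduct.map p q y) =
      TensorProduct.map P Q (TensorProduct.map ι j y) := by
  have e₁ : ι' ∘ₗ p = P ∘ₗ ι := LinearMap.ext h₁
  have e₂ : j' ∘ₗ q = Q ∘ₗ j := LinearMap.ext h₂
  rw [TensorProduct.map_map, TensorProduct.map_map, e₁, e₂]

variable [Coalgebra k A]

/-- The coalgebra structure on `B` for which an injection `ι : B → A` with
`Δ(ι(B)) ⊆ ι(B) ⊗ ι(B)` is a morphism of coalgebras. -/
@[reducible]
def inducedCoalgebra (ι : B →ₗ[k] A) (hι : Function.Injective ι)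
    (h : ∀ b, Coalgebra.comul (R := k) (ι b) ∈ LinearMap.range (TensorProduct.map ι ι)) :
    Coalgebra k B := by
  let d : B →ₗ[k] B ⊗[k] B :=
    (LinearEquiv.ofInjective (TensorProduct.map ι ι) (map_injective ι ι hι hι)).symm.toLinearMap ∘ₗ
      (Coalgebra.comul ∘ₗ ι).codRestrict (LinearMap.range (TensorProduct.map ι ι)) h
  have hd : ∀ b, TensorProduct.map ι ι (d b) = Coalgebra.comul (R := k) (ι b) := fun b =>
    congrArg Subtype.val (LinearEquiv.apply_symm_apply
      (LinearEquiv.ofInjective (TensorProduct.map ι ι) (map_injective ι ι hι hι))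
      ((Coalgebra.comul ∘ₗ ι).codRestrict (LinearMap.range (TensorProduct.map ι ι)) h b))
  have hd' : TensorProduct.map ι ι ∘ₗ d = Coalgebra.comul ∘ₗ ι := LinearMap.ext hd
  refine
    { comul := d
      counit := Coalgebra.counit ∘ₗ ι
      coassoc := ?_
      rTensor_counit_comp_comul := ?_
      lTensor_counit_comp_comul := ?_ }
  · ext b
    apply map_injective ι (TensorProduct.map ι ι) hι (map_injective ι ι hι hι)
    have h1 : ∀ x : B ⊗[k] B, TensorProduct.map ι (TensorProduct.map ι ι)
        (TensorProduct.assoc k B B B (d.rTensor B x)) =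
        TensorProduct.assoc k A A A
          ((Coalgebra.comul (R := k) (A := A)).rTensor A (TensorProduct.map ι ι x)) := by
      intro x
      rw [← LinearMap.comp_apply (LinearMap.rTensor A _), LinearMap.rTensor_comp_map, ← hd',
        TensorProduct.map_map_assoc]
      congr 1
      rw [← LinearMap.comp_apply (TensorProduct.map (TensorProduct.map ι ι) ι),
        LinearMap.map_comp_rTensor]
    have h2 : ∀ x : B ⊗[k] B, TensorProduct.map ι (TensorProduct.map ι ι) (d.lTensor B x) =
        (Coalgebra.comul (R := k) (A := A)).lTensor A (TensorProduct.map ι ι x) := by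
      intro x
      rw [← LinearMap.comp_apply (LinearMap.lTensor A _), LinearMap.lTensor_comp_map, ← hd',
        ← LinearMap.comp_apply (TensorProduct.map ι (TensorProduct.map ι ι)),
        LinearMap.map_comp_lTensor]
    simp only [LinearMap.comp_apply, LinearEquiv.coe_coe]
    rw [h1, h2, hd, Coalgebra.coassoc_apply]
  · ext b
    apply map_injective LinearMap.id ι Function.injective_id hι
    have h1 : ∀ x : B ⊗[k] B, TensorProduct.map LinearMap.id ι
        ((Coalgebra.counit (R := k) ∘ₗ ι).rTensor B x) =
        (Coalgebra.counit (R := k) (A := A)).rTensor A (TensorProduct.map ι ι x) := by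
      intro x
      rw [← LinearMap.comp_apply (LinearMap.rTensor A _), LinearMap.rTensor_comp_map,
        ← LinearMap.comp_apply (TensorProduct.map LinearMap.id ι), LinearMap.map_comp_rTensor,
        LinearMap.id_comp]
    simp only [LinearMap.comp_apply]
    rw [h1, hd, Coalgebra.rTensor_counit_comul]
    simp
  · ext b
    apply map_injective ι LinearMap.id hι Function.injective_id
    have h1 : ∀ x : B ⊗[k] B, TensorProduct.map ι LinearMap.id
        ((Coalgebra.counit (R := k) ∘ₗ ι).lTensor B x) =
        (Coalgebra.counit (R := k) (A := A)).lTensor A (TensorProduct.map ι ι x) := by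
      intro x
      rw [← LinearMap.comp_apply (LinearMap.lTensor A _), LinearMap.lTensor_comp_map,
        ← LinearMap.comp_apply (TensorProduct.map ι LinearMap.id), LinearMap.map_comp_lTensor,
        LinearMap.id_comp]
    simp only [LinearMap.comp_apply]
    rw [h1, hd, Coalgebra.lTensor_counit_comul]
    simp

theorem map_inducedComul (ι : B →ₗ[k] A) (hι : Function.Injective ι)
    (h : ∀ b, Coalgebra.comul (R := k) (ι b) ∈ LinearMap.range (TensorProduct.map ι ι)) (b : B) :
    TensorProduct.map ι ι ((inducedCoalgebra ι hι h).comul b) = Coalgebra.comul (R := k) (ι b) :=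
  congrArg Subtype.val (LinearEquiv.apply_symm_apply
    (LinearEquiv.ofInjective (TensorProduct.map ι ι) (map_injective ι ι hι hι))
    ((Coalgebra.comul ∘ₗ ι).codRestrict (LinearMap.range (TensorProduct.map ι ι)) h b))

variable [Coalgebra k B]

/-- A linear map into `B` that becomes a coalgebra morphism after composing with an injective
coalgebra morphism `ι : B → A` is itself a coalgebra morphism. -/
def liftCoalgHom {C : Type*} [AddCommGroup C] [Module k C] [Coalgebra k C] (ι : B →ₗc[k] A)
    (hι : Function.Injective ι) (m : C →ₗ[k] B) (f : C →ₗc[k] A) (hm : ∀ c, ι (m c) = f c) :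
    C →ₗc[k] B where
  toLinearMap := m
  counit_comp := by
    ext c
    have h1 := CoalgHomClass.counit_comp_apply ι (m c)
    have h2 := CoalgHomClass.counit_comp_apply f c
    simp only [LinearMap.comp_apply]
    rw [← h1, hm, h2]
  map_comp_comul := by
    ext c
    apply map_injective ι.toLinearMap ι.toLinearMap hι hι
    have e : ι.toLinearMap ∘ₗ m = f.toLinearMap := LinearMap.ext hm
    have h1 := LinearMap.congr_fun ι.map_comp_comul (m c)
    have h2 := LinearMap.congr_fun f.map_comp_comul c
    simp only [LinearMap.comp_apply] at h1 h2 ⊢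
    rw [TensorProduct.map_map, e, h2, h1]
    exact congrArg Coalgebra.comul (hm c).symm

theorem leftHit_comp (ι : B →ₗc[k] A) (f : Module.Dual k A) (b : B) :
    ι (leftHit (f ∘ₗ ι.toLinearMap) b) = leftHit f (ι b) := by
  have h := LinearMap.congr_fun ι.map_comp_comul b
  simp only [LinearMap.comp_apply] at h
  have h1 : ∀ x : B ⊗[k] B, ι (TensorProduct.rid k B ((f ∘ₗ ι.toLinearMap).lTensor B x)) =
      TensorProduct.rid k A (f.lTensor A (TensorProduct.map ι.toLinearMap ι.toLinearMap x)) := by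
    intro x
    induction x with
    | zero => simp
    | add x y hx hy => simp only [map_add, hx, hy]
    | tmul x y => simp
  have h2 := h1 (Coalgebra.comul b)
  rw [h] at h2
  exact h2

theorem rightHit_comp (ι : B →ₗc[k] A) (f : Module.Dual k A) (b : B) :
    ι (rightHit (f ∘ₗ ι.toLinearMap) b) = rightHit f (ι b) := by
  have h := LinearMap.congr_fun ι.map_comp_comul b
  simp only [LinearMap.comp_apply] at h
  have h1 : ∀ x : B ⊗[k] B, ι (TensorProduct.lid k B ((f ∘ₗ ι.toLinearMap).rTensor B x)) =
      TensorProduct.lid k A (f.rTensor A (TensorProduct.map ι.toLinearMap ι.toLinearMap x)) := by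
    intro x
    induction x with
    | zero => simp
    | add x y hx hy => simp only [map_add, hx, hy]
    | tmul x y => simp
  have h2 := h1 (Coalgebra.comul b)
  rw [h] at h2
  exact h2

theorem comul₃_comp (ι : B →ₗc[k] A) (b : B) :
    TensorProduct.map ι.toLinearMap (TensorProduct.map ι.toLinearMap ι.toLinearMap)
      (comul₃ k B b) = comul₃ k A (ι b) := by
  have h := LinearMap.congr_fun ι.map_comp_comul b
  simp only [LinearMap.comp_apply] at h
  simp only [comul₃, LinearMap.comp_apply]
  rw [← LinearMap.comp_apply, LinearMap.map_comp_lTensor, ι.map_comp_comul,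
    ← LinearMap.lTensor_comp_map, LinearMap.comp_apply, h]
  rfl

theorem toConv_comp_mul {C : Type*} {D : Type*} [AddCommGroup C] [Module k C] [Coalgebra k C]
    [AddCommGroup D] [Module k D] [Coalgebra k D] (j : C →ₗc[k] D) (f g : Module.Dual k D) :
    toConv (f ∘ₗ j.toLinearMap) * toConv (g ∘ₗ j.toLinearMap) =
      toConv ((toConv f * toConv g).ofConv ∘ₗ j.toLinearMap) := by
  have h := LinearMap.convMul_comp_coalgHom_distrib (toConv f) (toConv g) j
  rw [h]

theorem mul_comp (H : DualQuasiBialgebra k A) (ι : B →ₗc[k] A) (m : B ⊗[k] B →ₗ[k] B)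
    (hm : ∀ a b, ι (m (a ⊗ₜ[k] b)) = H.M (ι a ⊗ₜ[k] ι b)) (x : B ⊗[k] B) :
    ι (m x) = (H.M.comp (Coalgebra.TensorProduct.map ι ι)) x := by
  have : ι.toLinearMap ∘ₗ m = (H.M.comp (Coalgebra.TensorProduct.map ι ι)).toLinearMap :=
    TensorProduct.ext' hm
  exact LinearMap.congr_fun this x

/-- The dual quasi-bialgebra structure on `B` restricted along an injective coalgebra morphism
`ι : B → A` whose image is closed under multiplication and contains the unit. -/
def DualQuasiBialgebra.restrict (H : DualQuasiBialgebra k A) (ι : B →ₗc[k] A)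
    (hι : Function.Injective ι) (m : B ⊗[k] B →ₗ[k] B) (e : k →ₗ[k] B)
    (hm : ∀ a b, ι (m (a ⊗ₜ[k] b)) = H.M (ι a ⊗ₜ[k] ι b)) (he : ∀ c, ι (e c) = H.u c) :
    DualQuasiBialgebra k B := by
  let I₂ := Coalgebra.TensorProduct.map ι ι
  let I₃ := Coalgebra.TensorProduct.map ι I₂
  let I₄ := Coalgebra.TensorProduct.map ι I₃
  have hm' := mul_comp H ι m hm
  refine
    { M := liftCoalgHom ι hι m (H.M.comp I₂) hm'
      u := liftCoalgHom ι hι e H.u he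
      φ := H.φ ∘ₗ I₃.toLinearMap
      φInv := H.φInv ∘ₗ I₃.toLinearMap
      φ_mul_φInv := ?_
      φInv_mul_φ := ?_
      quasi_assoc := ?_
      one_mul := ?_
      mul_one := ?_
      cocycle := ?_
      φ_one := ?_ }
  · rw [toConv_comp_mul, H.φ_mul_φInv]
    exact congrArg toConv (I₃.counit_comp)
  · rw [toConv_comp_mul, H.φInv_mul_φ]
    exact congrArg toConv (I₃.counit_comp)
  · refine LinearMap.ext fun x => hι ?_
    have hc := LinearMap.congr_fun I₃.map_comp_comul x
    simp only [LinearMap.comp_apply] at hc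
    have hq := LinearMap.congr_fun H.quasi_assoc (I₃ x)
    have h1 : ∀ c, ι.toLinearMap ((m ∘ₗ m.lTensor B) c) =
        (H.M.toLinearMap ∘ₗ H.M.toLinearMap.lTensor A) (I₃.toLinearMap c) := by
      refine LinearMap.congr_fun (f := ι.toLinearMap ∘ₗ m ∘ₗ m.lTensor B)
        (g := (H.M.toLinearMap ∘ₗ H.M.toLinearMap.lTensor A) ∘ₗ I₃.toLinearMap) ?_
      apply TensorProduct.ext_threefold'
      intro a b c
      exact (hm a _).trans (congrArg (fun z => H.M (ι a ⊗ₜ[k] z)) (hm b c))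
    have h2 : ∀ c, ι.toLinearMap ((m ∘ₗ m.rTensor B ∘ₗ
        (TensorProduct.assoc k B B B).symm.toLinearMap) c) =
        (H.M.toLinearMap ∘ₗ H.M.toLinearMap.rTensor A ∘ₗ
          (TensorProduct.assoc k A A A).symm.toLinearMap) (I₃.toLinearMap c) := by
      refine LinearMap.congr_fun (f := ι.toLinearMap ∘ₗ m ∘ₗ m.rTensor B ∘ₗ
          (TensorProduct.assoc k B B B).symm.toLinearMap)
        (g := (H.M.toLinearMap ∘ₗ H.M.toLinearMap.rTensor A ∘ₗ
          (TensorProduct.assoc k A A A).symm.toLinearMap) ∘ₗ I₃.toLinearMap) ?_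
      apply TensorProduct.ext_threefold'
      intro a b c
      exact (hm _ c).trans (congrArg (fun z => H.M (z ⊗ₜ[k] ι c)) (hm a b))
    have e1 := rid_map_comp ι.toLinearMap I₃.toLinearMap _ _ H.φ h1 (Coalgebra.comul x)
    have e2 := lid_map_comp ι.toLinearMap I₃.toLinearMap _ _ H.φ h2 (Coalgebra.comul x)
    rw [hc] at e1 e2
    exact e1.trans (hq.trans e2.symm)
  · intro a
    apply hι
    change ι (m (e 1 ⊗ₜ[k] a)) = ι a
    rw [hm, he, H.one_mul]
  · intro a
    apply hι
    change ι (m (a ⊗ₜ[k] e 1)) = ι a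
    rw [hm, he, H.mul_one]
  · change toConv ((H.φ ∘ₗ I₃.toLinearMap) ∘ₗ (m.lTensor B).lTensor B) *
        toConv ((H.φ ∘ₗ I₃.toLinearMap) ∘ₗ m.rTensor (B ⊗[k] B) ∘ₗ
          (TensorProduct.assoc k B B (B ⊗[k] B)).symm.toLinearMap) =
      toConv ((H.φ ∘ₗ I₃.toLinearMap) ∘ₗ
          (TensorProduct.lid k (B ⊗[k] (B ⊗[k] B))).toLinearMap ∘ₗ
          (Coalgebra.counit (R := k) (A := B)).rTensor (B ⊗[k] (B ⊗[k] B))) *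
        toConv ((H.φ ∘ₗ I₃.toLinearMap) ∘ₗ (m.rTensor B ∘ₗ
          (TensorProduct.assoc k B B B).symm.toLinearMap).lTensor B) *
        toConv ((H.φ ∘ₗ I₃.toLinearMap) ∘ₗ (((TensorProduct.rid k B).toLinearMap ∘ₗ
          (Coalgebra.counit (R := k) (A := B)).lTensor B).lTensor B).lTensor B)
    have hε : ∀ b, Coalgebra.counit (R := k) (ι b) = Coalgebra.counit (R := k) b :=
      CoalgHomClass.counit_comp_apply ι
    have f1 : (H.φ ∘ₗ I₃.toLinearMap) ∘ₗ (m.lTensor B).lTensor B =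
        (H.φ ∘ₗ (H.M.toLinearMap.lTensor A).lTensor A) ∘ₗ I₄.toLinearMap := by
      ext a b c d
      exact congrArg (fun z => H.φ (ι a ⊗ₜ[k] (ι b ⊗ₜ[k] z))) (hm c d)
    have f2 : (H.φ ∘ₗ I₃.toLinearMap) ∘ₗ m.rTensor (B ⊗[k] B) ∘ₗ
          (TensorProduct.assoc k B B (B ⊗[k] B)).symm.toLinearMap =
        (H.φ ∘ₗ H.M.toLinearMap.rTensor (A ⊗[k] A) ∘ₗ
          (TensorProduct.assoc k A A (A ⊗[k] A)).symm.toLinearMap) ∘ₗ I₄.toLinearMap := by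
      ext a b c d
      exact congrArg (fun z => H.φ (z ⊗ₜ[k] (ι c ⊗ₜ[k] ι d))) (hm a b)
    have f3 : (H.φ ∘ₗ I₃.toLinearMap) ∘ₗ
          (TensorProduct.lid k (B ⊗[k] (B ⊗[k] B))).toLinearMap ∘ₗ
          (Coalgebra.counit (R := k) (A := B)).rTensor (B ⊗[k] (B ⊗[k] B)) =
        (H.φ ∘ₗ (TensorProduct.lid k (A ⊗[k] (A ⊗[k] A))).toLinearMap ∘ₗ
          (Coalgebra.counit (R := k) (A := A)).rTensor (A ⊗[k] (A ⊗[k] A))) ∘ₗ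
            I₄.toLinearMap := by
      ext a b c d
      change H.φ (I₃ (Coalgebra.counit (R := k) a • (b ⊗ₜ[k] (c ⊗ₜ[k] d)))) =
        H.φ (Coalgebra.counit (R := k) (ι a) • (ι b ⊗ₜ[k] (ι c ⊗ₜ[k] ι d)))
      rw [hε, map_smul]
      rfl
    have f4 : (H.φ ∘ₗ I₃.toLinearMap) ∘ₗ (m.rTensor B ∘ₗ
          (TensorProduct.assoc k B B B).symm.toLinearMap).lTensor B =
        (H.φ ∘ₗ (H.M.toLinearMap.rTensor A ∘ₗ
          (TensorProduct.assoc k A A A).symm.toLinearMap).lTensor A) ∘ₗ I₄.toLinearMap := by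
      ext a b c d
      exact congrArg (fun z => H.φ (ι a ⊗ₜ[k] (z ⊗ₜ[k] ι d))) (hm b c)
    have f5 : (H.φ ∘ₗ I₃.toLinearMap) ∘ₗ (((TensorProduct.rid k B).toLinearMap ∘ₗ
          (Coalgebra.counit (R := k) (A := B)).lTensor B).lTensor B).lTensor B =
        (H.φ ∘ₗ (((TensorProduct.rid k A).toLinearMap ∘ₗ
          (Coalgebra.counit (R := k) (A := A)).lTensor A).lTensor A).lTensor A) ∘ₗ
            I₄.toLinearMap := by
      ext a b c d
      change H.φ (ι a ⊗ₜ[k] (ι b ⊗ₜ[k] ι (Coalgebra.counit (R := k) d • c))) =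
        H.φ (ι a ⊗ₜ[k] (ι b ⊗ₜ[k] (Coalgebra.counit (R := k) (ι d) • ι c)))
      rw [hε, map_smul]
    rw [f1, f2, f3, f4, f5, toConv_comp_mul, toConv_comp_mul, toConv_comp_mul, H.cocycle]
  · intro a b
    change H.φ (ι a ⊗ₜ[k] (ι (e 1) ⊗ₜ[k] ι b)) = _
    rw [he, H.φ_one, CoalgHomClass.counit_comp_apply, CoalgHomClass.counit_comp_apply]

/-- The dual quasi-Hopf algebra structure on `B` restricted along an injective coalgebra morphism
`ι : B → A` whose image is closed under multiplication and the antipode and contains the unit. -/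
def DualQuasiHopfAlgebra.restrict (H : DualQuasiHopfAlgebra k A) (ι : B →ₗc[k] A)
    (hι : Function.Injective ι) (m : B ⊗[k] B →ₗ[k] B) (e : k →ₗ[k] B) (s : B →ₗ[k] B)
    (hm : ∀ a b, ι (m (a ⊗ₜ[k] b)) = H.M (ι a ⊗ₜ[k] ι b)) (he : ∀ c, ι (e c) = H.u c)
    (hs : ∀ b, ι (s b) = H.S (ι b)) :
    DualQuasiHopfAlgebra k B where
  toDualQuasiBialgebra := H.toDualQuasiBialgebra.restrict ι hι m e hm he
  S := s
  counit_S := by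
    ext b
    have h := LinearMap.congr_fun H.counit_S (ι b)
    simp only [LinearMap.comp_apply] at h ⊢
    rw [← CoalgHomClass.counit_comp_apply ι, hs, h, CoalgHomClass.counit_comp_apply]
  comul_S := by
    ext b
    apply map_injective ι.toLinearMap ι.toLinearMap hι hι
    have h := LinearMap.congr_fun H.comul_S (ι b)
    have hc := LinearMap.congr_fun ι.map_comp_comul b
    have hc' := LinearMap.congr_fun ι.map_comp_comul (s b)
    have e : ι.toLinearMap ∘ₗ s = H.S ∘ₗ ι.toLinearMap := LinearMap.ext hs
    simp only [LinearMap.comp_apply, LinearEquiv.coe_coe] at h hc hc' ⊢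
    rw [hc', TensorProduct.map_comm, TensorProduct.map_map, e, ← TensorProduct.map_map, hc]
    exact (congrArg Coalgebra.comul (hs b)).trans h
  α := H.α ∘ₗ ι.toLinearMap
  β := H.β ∘ₗ ι.toLinearMap
  antipode_α b := by
    apply hι
    have hc := LinearMap.congr_fun ι.map_comp_comul b
    simp only [LinearMap.comp_apply] at hc
    have h := H.antipode_α (ι b)
    have e' := map_map_of_comm ι.toLinearMap ι.toLinearMap ι.toLinearMap ι.toLinearMap s H.S
      (rightHit (H.α ∘ₗ ι.toLinearMap)) (rightHit H.α) hs (rightHit_comp ι H.α)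
      (Coalgebra.comul b)
    rw [hc] at e'
    refine ((mul_comp H.toDualQuasiBialgebra ι m hm _).trans (congrArg H.M e')).trans (h.trans ?_)
    change H.α (ι b) • H.u 1 = ι (H.α (ι b) • e 1)
    rw [map_smul, he]
  antipode_β b := by
    apply hι
    have hc := LinearMap.congr_fun ι.map_comp_comul b
    simp only [LinearMap.comp_apply] at hc
    have h := H.antipode_β (ι b)
    have e' := map_map_of_comm ι.toLinearMap ι.toLinearMap ι.toLinearMap ι.toLinearMap
      (leftHit (H.β ∘ₗ ι.toLinearMap)) (leftHit H.β) s H.S (leftHit_comp ι H.β) hs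
      (Coalgebra.comul b)
    rw [hc] at e'
    refine ((mul_comp H.toDualQuasiBialgebra ι m hm _).trans (congrArg H.M e')).trans (h.trans ?_)
    change H.β (ι b) • H.u 1 = ι (H.β (ι b) • e 1)
    rw [map_smul, he]
  antipode_φ b := by
    have e' := map_map_of_comm ι.toLinearMap _ ι.toLinearMap _
      (leftHit (H.β ∘ₗ ι.toLinearMap)) (leftHit H.β)
      (TensorProduct.map s (rightHit (H.α ∘ₗ ι.toLinearMap))) (TensorProduct.map H.S (rightHit H.α))
      (leftHit_comp ι H.β)
      (map_map_of_comm ι.toLinearMap ι.toLinearMap ι.toLinearMap ι.toLinearMap s H.S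
        (rightHit (H.α ∘ₗ ι.toLinearMap)) (rightHit H.α) hs (rightHit_comp ι H.α))
      (comul₃ k B b)
    rw [comul₃_comp] at e'
    exact (congrArg H.φ e').trans
      ((H.antipode_φ (ι b)).trans (CoalgHomClass.counit_comp_apply ι b))
  antipode_φInv b := by
    have hsβ : ∀ x, ι.toLinearMap ((s ∘ₗ rightHit (H.β ∘ₗ ι.toLinearMap)) x) =
        (H.S ∘ₗ rightHit H.β) (ι.toLinearMap x) := fun x =>
      (hs _).trans (congrArg H.S (rightHit_comp ι H.β x))
    have e' := map_map_of_comm ι.toLinearMap _ ι.toLinearMap _ s H.S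
      (TensorProduct.map (rightHit (H.α ∘ₗ ι.toLinearMap)) (s ∘ₗ rightHit (H.β ∘ₗ ι.toLinearMap)))
      (TensorProduct.map (rightHit H.α) (H.S ∘ₗ rightHit H.β)) hs
      (map_map_of_comm ι.toLinearMap ι.toLinearMap ι.toLinearMap ι.toLinearMap
        (rightHit (H.α ∘ₗ ι.toLinearMap)) (rightHit H.α) (s ∘ₗ rightHit (H.β ∘ₗ ι.toLinearMap))
        (H.S ∘ₗ rightHit H.β) (rightHit_comp ι H.α) hsβ)
      (comul₃ k B b)
    rw [comul₃_comp] at e'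
    exact (congrArg H.φInv e').trans
      ((H.antipode_φInv (ι b)).trans (CoalgHomClass.counit_comp_apply ι b))

end Restriction

section Subalgebra

variable {k : Type u} {A : Type v} [Field k] [AddCommGroup A] [Module k A] [Coalgebra k A]

/-- A dual quasi-Hopf subalgebra of `A`: a subcoalgebra (`Δ(B) ⊆ B ⊗ B`) closed under the
multiplication and the antipode and containing the unit. -/
structure DualQuasiHopfSubalgebra (H : DualQuasiHopfAlgebra k A) where
  toSubmodule : Submodule k A
  comul_mem : ∀ b ∈ toSubmodule, Coalgebra.comul (R := k) b ∈
    LinearMap.range (TensorProduct.map toSubmodule.subtype toSubmodule.subtype)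
  mul_mem : ∀ a ∈ toSubmodule, ∀ b ∈ toSubmodule, H.M (a ⊗ₜ[k] b) ∈ toSubmodule
  one_mem : H.u 1 ∈ toSubmodule
  antipode_mem : ∀ b ∈ toSubmodule, H.S b ∈ toSubmodule

namespace DualQuasiHopfSubalgebra

variable {H : DualQuasiHopfAlgebra k A} (B : DualQuasiHopfSubalgebra H)

instance instCoalgebra : Coalgebra k B.toSubmodule :=
  inducedCoalgebra B.toSubmodule.subtype B.toSubmodule.subtype_injective
    (fun b => B.comul_mem b b.2)

/-- The inclusion `B → A` as a morphism of coalgebras. -/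
def incl : B.toSubmodule →ₗc[k] A where
  toLinearMap := B.toSubmodule.subtype
  counit_comp := rfl
  map_comp_comul := LinearMap.ext (map_inducedComul B.toSubmodule.subtype
    B.toSubmodule.subtype_injective (fun b => B.comul_mem b b.2))

theorem mul_restrict_mem (x : B.toSubmodule ⊗[k] B.toSubmodule) :
    H.M (TensorProduct.map B.toSubmodule.subtype B.toSubmodule.subtype x) ∈ B.toSubmodule := by
  induction x with
  | zero => simp
  | add x y hx hy => rw [map_add, map_add]; exact B.toSubmodule.add_mem hx hy
  | tmul x y => exact B.mul_mem x x.2 y y.2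

/-- `B` with the restricted structure maps is a dual quasi-Hopf algebra. -/
def toDualQuasiHopfAlgebra : DualQuasiHopfAlgebra k B.toSubmodule :=
  H.restrict B.incl B.toSubmodule.subtype_injective
    ((H.M.toLinearMap ∘ₗ TensorProduct.map B.toSubmodule.subtype
      B.toSubmodule.subtype).codRestrict B.toSubmodule B.mul_restrict_mem)
    (H.u.toLinearMap.codRestrict B.toSubmodule (fun c => by
      have h : H.u c = c • H.u 1 := by rw [← map_smul, smul_eq_mul, _root_.mul_one]
      exact h ▸ B.toSubmodule.smul_mem c B.one_mem))
    ((H.S ∘ₗ B.toSubmodule.subtype).codRestrict B.toSubmodule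
      (fun b => B.antipode_mem b b.2))
    (fun _ _ => rfl) (fun _ => rfl) (fun _ => rfl)

end DualQuasiHopfSubalgebra
end Subalgebra
end DualQuasi
end

/-! The corollary is reduced to a criterion that passes visibly to subcoalgebras. Write `f ⇀ x = ∑
f(x₂) x₁` and `x ↼ f = ∑ f(x₁) x₂`. Non-zero left integrals exist as soon as some non-zero `f` has
`f ⇀ ·` of finite rank, and non-zero right integrals as soon as some non-zero `f` has `· ↼ f` of
finite rank. Conversely, a non-zero left integral produces `g` with `· ↼ g` of finite rank and
moreover `g(1) ≠ 0`; a right integral does the same for `⇀`. So left and right integrals exist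
together, and since `1 ∈ B` the functionals found on `A` restrict to non-zero functionals on `B`,
where the rank is still finite.

Both directions rest on the operation `x ∘ y = ∑ φ(x₁, S(y₂), y₄) α(y₃) x₂ S(y₁)`
(`quasiMulAntipode`), which replaces `x S(y)`. Two Hopf identities survive: `∑ x₁ θ(x₂ S(y)) = ∑ (θ
⇀ (x S(y₁))) y₂` (`hit_twist`, from quasi-associativity and the `α` axiom), and `∑ (x y₁) S(y₂) =
ε(y) x` with suitable coefficients (`exists_sum_quasiMulAntipode_eq`, which also needs the pentagon
and the `β` and `φ` axioms).

From finite rank to an integral: the image of `f ⇀ ·` is a finite-dimensional left coideal with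
coefficient comatrix `a`. Contracting its coordinate functionals with `β(a)` gives a column of
functionals that `S(a)` carries to multiples of `1`; twisting by `∘` turns such a column into
integrals, and the second identity prevents all of them from vanishing. From an integral `T` to
finite rank: with `T(aᵢⱼ) ≠ 0`, the functional `g = T(aᵢⱼ ∘ ·)` works by the first identity.

All computations take place on comatrices, which span any coalgebra. There convolution becomes
matrix multiplication and every axiom becomes a matrix identity. Passing to the opposite
multiplication and comultiplication (`mirror`) exchanges left and right, so each argument is needed
on one side only. -/

noncomputable section

namespace DualQuasi

universe u v

/-! ### Matrices of functions of several variables -/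

section FunctionMatrices

variable {k : Type u} {A : Type v}

/-- The matrix of a function of three variables on a triple of square arrays. -/
def matrix₃ {I J K : Type*} (F : A → A → A → k) (a : I → I → A) (b : J → J → A)
    (c : K → K → A) : Matrix (I × J × K) (I × J × K) k :=
  Matrix.of fun x y => F (a x.1 y.1) (b x.2.1 y.2.1) (c x.2.2 y.2.2)

/-- The matrix of a function of four variables on a quadruple of square arrays. -/
def matrix₄ {I J K L : Type*} (F : A → A → A → A → k) (a : I → I → A) (b : J → J → A)
    (c : K → K → A) (d : L → L → A) : Matrix (I × J × K × L) (I × J × K × L) k :=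
  Matrix.of fun x y => F (a x.1 y.1) (b x.2.1 y.2.1) (c x.2.2.1 y.2.2.1) (d x.2.2.2 y.2.2.2)

/-- The equivalence reversing a triple. -/
def revTriple (I J K : Type*) : I × J × K ≃ K × J × I where
  toFun x := (x.2.2, x.2.1, x.1)
  invFun x := (x.2.2, x.2.1, x.1)
  left_inv _ := rfl
  right_inv _ := rfl

/-- The equivalence reversing a quadruple. -/
def revQuadruple (I J K L : Type*) : I × J × K × L ≃ L × K × J × I where
  toFun x := (x.2.2.2, x.2.2.1, x.2.1, x.1)
  invFun x := (x.2.2.2, x.2.2.1, x.2.1, x.1)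
  left_inv _ := rfl
  right_inv _ := rfl

end FunctionMatrices

/-! ### Comatrices -/

section Comatrices

variable {k : Type u} {A : Type v} [Field k] [AddCommGroup A] [Module k A]

/-- `a` is a comatrix: `Δ(aᵢⱼ) = ∑ aᵢₗ ⊗ aₗⱼ` and `ε(aᵢⱼ) = δᵢⱼ`. -/
structure IsComatrix (Δ : A →ₗ[k] A ⊗[k] A) (ε : A →ₗ[k] k) {I : Type*} [Fintype I]
    [DecidableEq I] (a : I → I → A) : Prop where
  comul : ∀ i j, Δ (a i j) = ∑ l, a i l ⊗ₜ[k] a l j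
  counit : ∀ i j, ε (a i j) = (1 : Matrix I I k) i j

namespace IsComatrix

variable {Δ : A →ₗ[k] A ⊗[k] A} {ε : A →ₗ[k] k} {I J : Type*} [Fintype I] [DecidableEq I]
  [Fintype J] [DecidableEq J] {a : I → I → A}

theorem reindex (ha : IsComatrix Δ ε a) (e : J ≃ I) :
    IsComatrix Δ ε (fun i j => a (e i) (e j)) where
  comul i j := by
    rw [ha.comul]
    exact (e.sum_comp fun l => a (e i) l ⊗ₜ[k] a l (e j)).symm
  counit i j := by simp [ha.counit, Matrix.one_apply]

theorem transpose (ha : IsComatrix Δ ε a) :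
    IsComatrix ((TensorProduct.comm k A A).toLinearMap ∘ₗ Δ) ε (fun i j => a j i) where
  comul i j := by simp [ha.comul]
  counit i j := by rw [ha.counit, Matrix.one_apply, Matrix.one_apply]; simp [eq_comm]

theorem transpose_of_comm
    (ha : IsComatrix ((TensorProduct.comm k A A).toLinearMap ∘ₗ Δ) ε a) :
    IsComatrix Δ ε (fun i j => a j i) := by
  have h := ha.transpose
  have e : (TensorProduct.comm k A A).toLinearMap ∘ₗ
      (TensorProduct.comm k A A).toLinearMap ∘ₗ Δ = Δ := by
    ext x; simp
  rwa [e] at h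

end IsComatrix

/-- The map `f ⇀ x = ∑ x₁ f(x₂)` for a comultiplication `Δ`. -/
def hit (Δ : A →ₗ[k] A ⊗[k] A) (f : Module.Dual k A) : A →ₗ[k] A :=
  (TensorProduct.rid k A).toLinearMap ∘ₗ f.lTensor A ∘ₗ Δ

theorem IsComatrix.hit_apply {Δ : A →ₗ[k] A ⊗[k] A} {ε : A →ₗ[k] k} {I : Type*} [Fintype I]
    [DecidableEq I] {a : I → I → A} (ha : IsComatrix Δ ε a) (f : Module.Dual k A) (i j : I) :
    hit Δ f (a i j) = ∑ l, f (a l j) • a i l := by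
  simp [hit, ha.comul]

end Comatrices

/-! ### The axioms as matrix identities, and their left-right mirror -/

/-- The structure of a dual quasi-Hopf algebra expressed through comatrices. It is spanned by
entries of comatrices, and the axioms are matrix identities. -/
structure ComatrixQuasiHopf (k : Type u) (A : Type v) [Field k] [AddCommGroup A]
    [Module k A] where
  comul : A →ₗ[k] A ⊗[k] A
  counit : Module.Dual k A
  mul : A ⊗[k] A →ₗ[k] A
  one : A
  φ : Module.Dual k (A ⊗[k] (A ⊗[k] A))
  φInv : Module.Dual k (A ⊗[k] (A ⊗[k] A))
  S : A →ₗ[k] A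
  α : Module.Dual k A
  β : Module.Dual k A
  span_comatrix : ∀ x : A, ∃ (n : ℕ) (a : Fin n → Fin n → A), IsComatrix comul counit a ∧
    x ∈ Submodule.span k (Set.range fun p : Fin n × Fin n => a p.1 p.2)
  isComatrix_one : IsComatrix comul counit (fun _ _ : Unit => one)
  isComatrix_mul : ∀ {I J : Type} [Fintype I] [DecidableEq I] [Fintype J] [DecidableEq J]
    {a : I → I → A} {b : J → J → A}, IsComatrix comul counit a → IsComatrix comul counit b →
    IsComatrix comul counit (fun x y : I × J => mul (a x.1 y.1 ⊗ₜ[k] b x.2 y.2))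
  isComatrix_S : ∀ {I : Type} [Fintype I] [DecidableEq I] {a : I → I → A},
    IsComatrix comul counit a → IsComatrix comul counit (fun i j => S (a j i))
  one_mul : ∀ a, mul (one ⊗ₜ[k] a) = a
  mul_one : ∀ a, mul (a ⊗ₜ[k] one) = a
  φ_one : ∀ a b, φ (a ⊗ₜ[k] (one ⊗ₜ[k] b)) = counit a * counit b
  φ_mul_φInv : ∀ {I J K : Type} [Fintype I] [DecidableEq I] [Fintype J] [DecidableEq J]
    [Fintype K] [DecidableEq K] {a : I → I → A} {b : J → J → A} {c : K → K → A},
    IsComatrix comul counit a → IsComatrix comul counit b → IsComatrix comul counit c →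
    matrix₃ (fun x y z => φ (x ⊗ₜ[k] (y ⊗ₜ[k] z))) a b c *
      matrix₃ (fun x y z => φInv (x ⊗ₜ[k] (y ⊗ₜ[k] z))) a b c = 1
  quasi_assoc : ∀ (f : Module.Dual k A) {I J K : Type} [Fintype I] [DecidableEq I] [Fintype J]
    [DecidableEq J] [Fintype K] [DecidableEq K] {a : I → I → A} {b : J → J → A}
    {c : K → K → A},
    IsComatrix comul counit a → IsComatrix comul counit b → IsComatrix comul counit c →
    matrix₃ (fun x y z => f (mul (x ⊗ₜ[k] mul (y ⊗ₜ[k] z)))) a b c *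
      matrix₃ (fun x y z => φ (x ⊗ₜ[k] (y ⊗ₜ[k] z))) a b c =
    matrix₃ (fun x y z => φ (x ⊗ₜ[k] (y ⊗ₜ[k] z))) a b c *
      matrix₃ (fun x y z => f (mul (mul (x ⊗ₜ[k] y) ⊗ₜ[k] z))) a b c
  pentagon : ∀ {I J K L : Type} [Fintype I] [DecidableEq I] [Fintype J] [DecidableEq J]
    [Fintype K] [DecidableEq K] [Fintype L] [DecidableEq L] {a : I → I → A} {b : J → J → A}
    {c : K → K → A} {d : L → L → A},
    IsComatrix comul counit a → IsComatrix comul counit b → IsComatrix comul counit c →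
    IsComatrix comul counit d →
    matrix₄ (fun x y z w => φ (x ⊗ₜ[k] (y ⊗ₜ[k] mul (z ⊗ₜ[k] w)))) a b c d *
      matrix₄ (fun x y z w => φ (mul (x ⊗ₜ[k] y) ⊗ₜ[k] (z ⊗ₜ[k] w))) a b c d =
    matrix₄ (fun x y z w => counit x * φ (y ⊗ₜ[k] (z ⊗ₜ[k] w))) a b c d *
      matrix₄ (fun x y z w => φ (x ⊗ₜ[k] (mul (y ⊗ₜ[k] z) ⊗ₜ[k] w))) a b c d *
      matrix₄ (fun x y z w => counit w * φ (x ⊗ₜ[k] (y ⊗ₜ[k] z))) a b c d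
  antipode_α : ∀ {I : Type} [Fintype I] [DecidableEq I] {a : I → I → A},
    IsComatrix comul counit a → ∀ i j,
    ∑ l, ∑ m, α (a l m) • mul (S (a i l) ⊗ₜ[k] a m j) = α (a i j) • one
  antipode_β : ∀ {I : Type} [Fintype I] [DecidableEq I] {a : I → I → A},
    IsComatrix comul counit a → ∀ i j,
    ∑ l, ∑ m, β (a l m) • mul (a i l ⊗ₜ[k] S (a m j)) = β (a i j) • one
  antipode_φ : ∀ {I : Type} [Fintype I] [DecidableEq I] {a : I → I → A},
    IsComatrix comul counit a → ∀ i j,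
    ∑ l, ∑ m, ∑ r, ∑ t, β (a l m) * α (a r t) *
      φ (a i l ⊗ₜ[k] (S (a m r) ⊗ₜ[k] a t j)) = (1 : Matrix I I k) i j

namespace ComatrixQuasiHopf

variable {k : Type u} {A : Type v} [Field k] [AddCommGroup A] [Module k A]

/-- The reversal `x ⊗ (y ⊗ z) ↦ z ⊗ (y ⊗ x)`. -/
def reverse (k : Type u) (A : Type v) [Field k] [AddCommGroup A] [Module k A] :
    A ⊗[k] (A ⊗[k] A) →ₗ[k] A ⊗[k] (A ⊗[k] A) :=
  (TensorProduct.assoc k A A A).toLinearMap ∘ₗ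
    (TensorProduct.comm k A A).toLinearMap.rTensor A ∘ₗ
    (TensorProduct.comm k A (A ⊗[k] A)).toLinearMap

/-- The structure with the opposite multiplication and comultiplication. -/
def mirror (D : ComatrixQuasiHopf k A) : ComatrixQuasiHopf k A where
  comul := (TensorProduct.comm k A A).toLinearMap ∘ₗ D.comul
  counit := D.counit
  mul := D.mul ∘ₗ (TensorProduct.comm k A A).toLinearMap
  one := D.one
  φ := D.φ ∘ₗ reverse k A
  φInv := D.φInv ∘ₗ reverse k A
  S := D.S
  α := D.β
  β := D.α
  span_comatrix x := by
    obtain ⟨n, a, ha, hx⟩ := D.span_comatrix x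
    refine ⟨n, fun i j => a j i, ha.transpose, ?_⟩
    refine Submodule.span_mono ?_ hx
    rintro _ ⟨p, rfl⟩
    exact ⟨p.swap, rfl⟩
  isComatrix_one := D.isComatrix_one.transpose
  isComatrix_mul ha hb :=
    ((D.isComatrix_mul hb.transpose_of_comm ha.transpose_of_comm).transpose).reindex
      (Equiv.prodComm _ _)
  isComatrix_S ha := (D.isComatrix_S ha.transpose_of_comm).transpose
  one_mul := D.mul_one
  mul_one := D.one_mul
  φ_one a b := (D.φ_one b a).trans (mul_comm _ _)
  φ_mul_φInv := by
    intro I J K _ _ _ _ _ _ a b c ha hb hc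
    have h := D.φ_mul_φInv hc.transpose_of_comm hb.transpose_of_comm ha.transpose_of_comm
    -- Comatrices of the mirror are transposes. Transposition reverses the matrix product, which is
    -- why the inverse identity is taken in the other order first, and `revTriple` undoes the
    -- reversal of the three arguments.
    have h' := congrArg (fun P => P.transpose.submatrix (revTriple I J K) (revTriple I J K))
      (mul_eq_one_comm.mp h)
    simp only [Matrix.transpose_mul, Matrix.transpose_one, Matrix.submatrix_one_equiv,
      ← Matrix.submatrix_mul_equiv _ _ _ (revTriple I J K) _] at h'
    exact h'
  quasi_assoc := by
    intro f I J K _ _ _ _ _ _ a b c ha hb hc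
    have h := D.quasi_assoc f hc.transpose_of_comm hb.transpose_of_comm ha.transpose_of_comm
    have h' := congrArg (fun P => P.transpose.submatrix (revTriple I J K) (revTriple I J K)) h
    simp only [Matrix.transpose_mul,
      ← Matrix.submatrix_mul_equiv _ _ _ (revTriple I J K) _] at h'
    exact h'.symm
  pentagon := by
    intro I J K L _ _ _ _ _ _ _ _ a b c d ha hb hc hd
    have h := D.pentagon hd.transpose_of_comm hc.transpose_of_comm hb.transpose_of_comm
      ha.transpose_of_comm
    have h' := congrArg (fun P => P.transpose.submatrix (revQuadruple I J K L)
      (revQuadruple I J K L)) h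
    simp only [Matrix.transpose_mul,
      ← Matrix.submatrix_mul_equiv _ _ _ (revQuadruple I J K L) _] at h'
    rw [mul_assoc]
    exact h'
  antipode_α := by
    intro I _ _ a ha i j
    rw [Finset.sum_comm]
    exact D.antipode_β ha.transpose_of_comm j i
  antipode_β := by
    intro I _ _ a ha i j
    rw [Finset.sum_comm]
    exact D.antipode_α ha.transpose_of_comm j i
  antipode_φ := by
    intro I _ _ a ha i j
    have h := D.antipode_φ ha.transpose_of_comm j i
    rw [← Matrix.transpose_apply (1 : Matrix I I k), Matrix.transpose_one] at h
    rw [← h]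
    simp only [← Fintype.sum_prod_type']
    refine Fintype.sum_equiv ⟨fun x => (x.2.2.2, x.2.2.1, x.2.1, x.1),
      fun x => (x.2.2.2, x.2.2.1, x.2.1, x.1), fun _ => rfl, fun _ => rfl⟩ _ _ fun x => ?_
    exact congrArg (· * _) (mul_comm _ _)

end ComatrixQuasiHopf

/-! ### Translates of functionals and normalization of the reassociator -/

namespace ComatrixQuasiHopf

variable {k : Type u} {A : Type v} [Field k] [AddCommGroup A] [Module k A]
  (D : ComatrixQuasiHopf k A)

theorem ext_comatrix {X : Type*} [AddCommGroup X] [Module k X] {F G : A →ₗ[k] X}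
    (h : ∀ (n : ℕ) (a : Fin n → Fin n → A), IsComatrix D.comul D.counit a →
      ∀ i j, F (a i j) = G (a i j)) : F = G := by
  ext x
  obtain ⟨n, a, ha, hx⟩ := D.span_comatrix x
  refine LinearMap.eqOn_span (f := F) (g := G) ?_ hx
  rintro _ ⟨p, rfl⟩
  exact h n a ha p.1 p.2

theorem counit_hit (f : Module.Dual k A) (x : A) : D.counit (hit D.comul f x) = f x := by
  suffices h : D.counit ∘ₗ hit D.comul f = f from LinearMap.congr_fun h x
  refine D.ext_comatrix fun n a ha i j => ?_
  simp [ha.hit_apply, ha.counit, Matrix.one_apply]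

theorem comul_hit (f : Module.Dual k A) (x : A) :
    D.comul (hit D.comul f x) = (hit D.comul f).lTensor A (D.comul x) := by
  suffices h : D.comul ∘ₗ hit D.comul f = (hit D.comul f).lTensor A ∘ₗ D.comul from
    LinearMap.congr_fun h x
  refine D.ext_comatrix fun n a ha i j => ?_
  simp only [LinearMap.comp_apply, ha.hit_apply, map_sum, map_smul, ha.comul,
    LinearMap.lTensor_tmul, TensorProduct.tmul_sum, TensorProduct.tmul_smul, Finset.smul_sum]
  rw [Finset.sum_comm]

theorem hit_comp_hit (f g : Module.Dual k A) :
    hit D.comul (f ∘ₗ hit D.comul g) = hit D.comul f ∘ₗ hit D.comul g := by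
  refine D.ext_comatrix fun n a ha i j => ?_
  simp only [LinearMap.comp_apply, ha.hit_apply, map_sum, map_smul, Finset.smul_sum,
    Finset.sum_smul, smul_smul, smul_eq_mul]
  rw [Finset.sum_comm]

theorem counit_one : D.counit D.one = 1 := by
  simpa using D.isComatrix_one.counit () ()

/-- On the one-by-one comatrix `1` the axiom `antipode_φ` exhibits `α(1)` as a factor of `1`. -/
theorem α_one_ne_zero : D.α D.one ≠ 0 := by
  intro h
  simpa [h] using D.antipode_φ D.isComatrix_one () ()

theorem S_one : D.S D.one = D.one := by
  have h := D.antipode_α D.isComatrix_one () ()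
  simp only [Finset.univ_unique, Finset.sum_const, Finset.card_singleton, _root_.one_smul,
    D.mul_one] at h
  exact smul_right_injective A D.α_one_ne_zero h

section Reassociator

variable {I J K : Type} [Fintype I] [DecidableEq I] [Fintype J] [DecidableEq J]
  {a : I → I → A} {b : J → J → A}

/-- Only the normalization in the middle variable is an axiom. The pentagon with its last two
arguments equal to `1` reads `X = X * X` for the matrix `X` of `φ(·, ·, 1)`, and `X` is invertible.
-/
theorem φ_right_one (ha : IsComatrix D.comul D.counit a) (hb : IsComatrix D.comul D.counit b)
    (i j : I) (p q : J) :
    D.φ (a i j ⊗ₜ[k] (b p q ⊗ₜ[k] D.one)) = (1 : Matrix I I k) i j * (1 : Matrix J J k) p q := by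
  have h1 := D.isComatrix_one
  have hp := D.pentagon ha hb h1 h1
  have hi := D.φ_mul_φInv ha hb (D.isComatrix_mul h1 h1)
  set X := matrix₃ (fun x y z => D.φ (x ⊗ₜ[k] (y ⊗ₜ[k] z))) a b
    (fun _ _ : Unit × Unit => D.mul (D.one ⊗ₜ[k] D.one)) with hX
  have e1 : matrix₄ (fun x y z w => D.φ (x ⊗ₜ[k] (y ⊗ₜ[k] D.mul (z ⊗ₜ[k] w)))) a b
    -- Keeping `1 · 1` unsimplified with index type `Unit × Unit` in `X` makes the index types agree
    -- definitionally.
    (fun _ _ : Unit => D.one) (fun _ _ : Unit => D.one) = X := rfl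
  have e2 : matrix₄ (fun x y z w => D.φ (D.mul (x ⊗ₜ[k] y) ⊗ₜ[k] (z ⊗ₜ[k] w))) a b
      (fun _ _ : Unit => D.one) (fun _ _ : Unit => D.one) = 1 := by
    ext ⟨i, p, _, _⟩ ⟨j, q, _, _⟩
    have := (D.isComatrix_mul ha hb).counit (i, p) (j, q)
    simp [matrix₄, D.φ_one, this, D.counit_one, Matrix.one_apply]
  have e3 : matrix₄ (fun x y z w => D.counit x * D.φ (y ⊗ₜ[k] (z ⊗ₜ[k] w))) a b
      (fun _ _ : Unit => D.one) (fun _ _ : Unit => D.one) = 1 := by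
    ext ⟨i, p, _, _⟩ ⟨j, q, _, _⟩
    simp [matrix₄, D.φ_one, ha.counit, hb.counit, D.counit_one, Matrix.one_apply, ite_and]
    split_ifs <;> rfl
  have e4 : matrix₄ (fun x y z w => D.φ (x ⊗ₜ[k] (D.mul (y ⊗ₜ[k] z) ⊗ₜ[k] w))) a b
      (fun _ _ : Unit => D.one) (fun _ _ : Unit => D.one) = X := by
    ext ⟨i, p, _, _⟩ ⟨j, q, _, _⟩
    simp [matrix₄, hX, matrix₃, D.mul_one]
  have e5 : matrix₄ (fun x y z w => D.counit w * D.φ (x ⊗ₜ[k] (y ⊗ₜ[k] z))) a b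
      (fun _ _ : Unit => D.one) (fun _ _ : Unit => D.one) = X := by
    ext ⟨i, p, _, _⟩ ⟨j, q, _, _⟩
    simp [matrix₄, hX, matrix₃, D.mul_one, D.counit_one]
  rw [e1, e2, e3, e4, e5, _root_.mul_one, _root_.one_mul] at hp
  have hX1 : X = 1 := by
    have := congrArg (· * matrix₃ (fun x y z => D.φInv (x ⊗ₜ[k] (y ⊗ₜ[k] z))) a b
      (fun _ _ : Unit × Unit => D.mul (D.one ⊗ₜ[k] D.one))) hp
    simp only [mul_assoc, hi, _root_.mul_one] at this
    exact this.symm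
  have := congrFun₂ hX1 (i, p, (), ()) (j, q, (), ())
  simp only [hX, matrix₃, D.mul_one, Matrix.of_apply, Matrix.one_apply, Prod.mk.injEq] at this ⊢
  rw [this]
  by_cases h : i = j <;> simp [h]

end Reassociator

/-! ### The substitute for `x S(y)` -/

/-- The map `x ⊗ y ↦ ∑ φ(x₁, S(y₂), y₄) α(y₃) x₂ S(y₁)`. -/
def quasiMulAntipode : A ⊗[k] A →ₗ[k] A :=
  (TensorProduct.lid k A).toLinearMap ∘ₗ TensorProduct.map D.φ D.mul ∘ₗ
    (TensorProduct.tensorTensorTensorComm k A A (A ⊗[k] A) A).toLinearMap ∘ₗ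
    TensorProduct.map D.comul ((TensorProduct.comm k A (A ⊗[k] A)).toLinearMap ∘ₗ
      TensorProduct.map D.S (TensorProduct.map D.S
        ((TensorProduct.lid k A).toLinearMap ∘ₗ D.α.rTensor A ∘ₗ D.comul)) ∘ₗ
      D.comul.lTensor A ∘ₗ D.comul)

end ComatrixQuasiHopf

namespace ComatrixQuasiHopf

variable {k : Type u} {A : Type v} [Field k] [AddCommGroup A] [Module k A]
  (D : ComatrixQuasiHopf k A)

section Rows

variable {I J : Type} [Fintype I] [DecidableEq I] [Fintype J] [DecidableEq J]
  {a : I → I → A} {b : J → J → A}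

theorem quasiMulAntipode_apply (ha : IsComatrix D.comul D.counit a)
    (hb : IsComatrix D.comul D.counit b) (i j : I) (p q : J) :
    D.quasiMulAntipode (a i j ⊗ₜ[k] b p q) = ∑ u, ∑ v, ∑ w, ∑ l,
      (D.α (b v w) * D.φ (a i l ⊗ₜ[k] (D.S (b u v) ⊗ₜ[k] b w q))) •
        D.mul (a l j ⊗ₜ[k] D.S (b p u)) := by
  simp only [quasiMulAntipode, LinearMap.comp_apply, TensorProduct.map_tmul, ha.comul, hb.comul,
    map_sum, LinearMap.lTensor_tmul, TensorProduct.tmul_sum, TensorProduct.sum_tmul,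
    LinearEquiv.coe_coe, TensorProduct.comm_tmul, LinearMap.rTensor_tmul,
    TensorProduct.lid_tmul, TensorProduct.tmul_smul,
    TensorProduct.tensorTensorTensorComm_tmul, map_smul, Finset.smul_sum, smul_smul]

/-- The row vector with entries `δᵢₘ α(bᵥᵤ)` at `(m, v, u)`. -/
def rowα (b : J → J → A) (i : I) : I × J × J → k :=
  fun x => if i = x.1 then D.α (b x.2.1 x.2.2) else 0

/-- The column vector with entries `δₘⱼ β(bᵥᵤ)` at `(m, v, u)`. -/
def colβ (b : J → J → A) (j : I) : I × J × J → k :=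
  fun x => if x.1 = j then D.β (b x.2.1 x.2.2) else 0

/-- The factorization row · matrix of `φ` · column exposes `φ` to quasi-associativity and the
pentagon: `α` sits in the row, and the functional applied to `x S(y)` in the column. -/
theorem apply_quasiMulAntipode (ha : IsComatrix D.comul D.counit a)
    (hb : IsComatrix D.comul D.counit b) (g : Module.Dual k A) (i j : I) (p q : J) :
    g (D.quasiMulAntipode (a i j ⊗ₜ[k] b p q)) =
      D.rowα b i ⬝ᵥ (matrix₃ (fun x y z => D.φ (x ⊗ₜ[k] (y ⊗ₜ[k] z))) a
        (fun u v => D.S (b v u)) b).mulVec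
        (fun x => if x.2.2 = q then g (D.mul (a x.1 j ⊗ₜ[k] D.S (b p x.2.1))) else 0) := by
  rw [D.quasiMulAntipode_apply ha hb]
  simp [dotProduct, Matrix.mulVec, rowα, matrix₃, Fintype.sum_prod_type, Finset.mul_sum]
  simp only [← Fintype.sum_prod_type']
  exact Fintype.sum_equiv ⟨fun x => (x.2.1, x.2.2.1, x.2.2.2, x.1),
    fun x => (x.2.2.2, x.1, x.2.1, x.2.2.1), fun _ => rfl, fun _ => rfl⟩ _ _
    fun x => mul_assoc _ _ _

/-- The `α` axiom contracts `S(y) z` to a scalar, leaving only the first variable inside `f`. -/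
theorem rowα_vecMul (hb : IsComatrix D.comul D.counit b) (f : Module.Dual k A) (i : I) :
    Matrix.vecMul (D.rowα b i) (matrix₃ (fun x y z => f (D.mul (x ⊗ₜ[k] D.mul (y ⊗ₜ[k] z)))) a
      (fun u v => D.S (b v u)) b) = ∑ m, f (a i m) • D.rowα b m := by
  ext ⟨m, v, w⟩
  have h := congrArg (fun z => f (D.mul (a i m ⊗ₜ[k] z))) (D.antipode_α hb v w)
  simp only [TensorProduct.tmul_sum, map_sum, TensorProduct.tmul_smul, map_smul, D.mul_one,
    smul_eq_mul] at h
  simp [Matrix.vecMul, dotProduct, rowα, matrix₃, Fintype.sum_prod_type, h, mul_comm]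

theorem mulVec_colβ (hb : IsComatrix D.comul D.counit b) (f : Module.Dual k A) (j : I) :
    (matrix₃ (fun x y z => f (D.mul (x ⊗ₜ[k] D.mul (y ⊗ₜ[k] z)))) a b
      (fun u v => D.S (b v u))).mulVec (D.colβ b j) = ∑ m, f (a m j) • D.colβ b m := by
  ext ⟨m, v, w⟩
  have h := congrArg (fun z => f (D.mul (a m j ⊗ₜ[k] z))) (D.antipode_β hb v w)
  simp only [TensorProduct.tmul_sum, map_sum, TensorProduct.tmul_smul, map_smul, D.mul_one,
    smul_eq_mul] at h
  simp [Matrix.mulVec, dotProduct, colβ, matrix₃, Fintype.sum_prod_type, h, mul_comm]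

end Rows

/-- The functional `x ↦ θ(∑ φ(x₁, S(y₂), y₄) α(y₃) x₂ S(y₁))`. -/
def twist (θ : Module.Dual k A) (y : A) : Module.Dual k A :=
  θ ∘ₗ D.quasiMulAntipode ∘ₗ (TensorProduct.mk k A A).flip y

@[simp]
theorem twist_apply (θ : Module.Dual k A) (y x : A) :
    D.twist θ y x = θ (D.quasiMulAntipode (x ⊗ₜ[k] y)) := rfl

section

variable {J : Type} [Fintype J] [DecidableEq J] {b : J → J → A}

/-- The Hopf identity `∑ x₁ θ(x₂ S(y)) = ∑ (θ ⇀ (x S(y₁))) y₂`. It holds here without correction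
terms because the `φ` and `α` built into `quasiMulAntipode` are exactly what quasi-associativity
needs. -/
theorem hit_twist (hb : IsComatrix D.comul D.counit b) (θ : Module.Dual k A) (p q : J) (x : A) :
    hit D.comul (D.twist θ (b p q)) x = ∑ t, D.mul
      (hit D.comul θ (D.quasiMulAntipode (x ⊗ₜ[k] b p t)) ⊗ₜ[k] b t q) := by
  suffices h : hit D.comul (D.twist θ (b p q)) = ∑ t, D.mul ∘ₗ
      (TensorProduct.mk k A A).flip (b t q) ∘ₗ hit D.comul θ ∘ₗ D.quasiMulAntipode ∘ₗ
        (TensorProduct.mk k A A).flip (b p t) by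
    rw [h]; simp
  refine D.ext_comatrix fun n a ha i j => ?_
  rw [← sub_eq_zero, ← Module.forall_dual_apply_eq_zero_iff k]
  intro f
  rw [map_sub, sub_eq_zero]
  have hs := D.isComatrix_S hb
  have hq := D.quasi_assoc f ha hs hb
  set Φ := matrix₃ (fun x y z => D.φ (x ⊗ₜ[k] (y ⊗ₜ[k] z))) a (fun u v => D.S (b v u)) b with hΦ
  set C : Fin n × J × J → k :=
    fun x => if x.2.2 = q then θ (D.mul (a x.1 j ⊗ₜ[k] D.S (b p x.2.1))) else 0 with hC
  have h1 : f (hit D.comul (D.twist θ (b p q)) (a i j)) =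
      (∑ m, f (a i m) • D.rowα b m) ⬝ᵥ Φ.mulVec C := by
    simp only [ha.hit_apply, twist_apply, map_sum, map_smul, smul_eq_mul,
      D.apply_quasiMulAntipode ha hb, sum_dotProduct, smul_dotProduct]
    exact Finset.sum_congr rfl fun m _ => mul_comm _ _
  -- The scalars `f(aᵢₘ)` are absorbed into the row as the matrix of `f(x(yz))`, which
  -- quasi-associativity then moves across `Φ` to act on the column as the matrix of `f((xy)z)`.
  rw [h1, ← D.rowα_vecMul hb, ← Matrix.dotProduct_mulVec, Matrix.mulVec_mulVec, hq,
    ← Matrix.mulVec_mulVec]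
  have h2 : (matrix₃ (fun x y z => f (D.mul (D.mul (x ⊗ₜ[k] y) ⊗ₜ[k] z))) a
      (fun u v => D.S (b v u)) b).mulVec C = ∑ t, fun x : Fin n × J × J => if x.2.2 = t then
        f (D.mul (hit D.comul θ (D.mul (a x.1 j ⊗ₜ[k] D.S (b p x.2.1))) ⊗ₜ[k] b t q)) else 0 := by
    ext ⟨l, u, t⟩
    have h3 := (D.isComatrix_mul ha hs).hit_apply θ (l, u) (j, p)
    simp only at h3
    simp [h3, Matrix.mulVec, dotProduct, hC, matrix₃, Fintype.sum_prod_type,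
      TensorProduct.sum_tmul, ← TensorProduct.smul_tmul', mul_comm]
  rw [h2, Matrix.mulVec_sum, dotProduct_sum]
  simp only [LinearMap.sum_apply, map_sum]
  refine Finset.sum_congr rfl fun t _ => ?_
  exact (D.apply_quasiMulAntipode ha hb (f ∘ₗ D.mul ∘ₗ
      (TensorProduct.mk k A A).flip (b t q) ∘ₗ hit D.comul θ) i j p t).symm

end

section

variable {I J : Type} [Fintype I] [DecidableEq I] [Fintype J] [DecidableEq J]
  {a : I → I → A} {b : J → J → A}

/-- The pentagon at `a, b, S(b), b`, written `P₁ P₂ = P₃ P₄ P₅`, is placed between a row `R` built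
from `α` and a column `C` built from `φ⁻¹` and `β`. The outer factors collapse and `R P₂ C` becomes
the left side of `antipode_φ`. -/
theorem rowα_dotProduct_pentagon (ha : IsComatrix D.comul D.counit a)
    (hb : IsComatrix D.comul D.counit b) (i j : I) (p q : J) :
    D.rowα b (i, p) ⬝ᵥ (matrix₃ (fun x y z => D.φ (x ⊗ₜ[k] (y ⊗ₜ[k] z)))
      (fun x y : I × J => D.mul (a x.1 y.1 ⊗ₜ[k] b x.2 y.2)) (fun u v => D.S (b v u)) b).mulVec
      (fun x => if x.2.2 = q then ((matrix₃ (fun x y z => D.φInv (x ⊗ₜ[k] (y ⊗ₜ[k] z))) a b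
        (fun u v => D.S (b v u))).mulVec (D.colβ b j)) (x.1.1, x.1.2, x.2.1) else 0) =
      (1 : Matrix I I k) i j * (1 : Matrix J J k) p q := by
  have hs := D.isComatrix_S hb
  have hp := D.pentagon ha hb hs hb
  set Ψ := matrix₃ (fun x y z => D.φInv (x ⊗ₜ[k] (y ⊗ₜ[k] z))) a b (fun u v => D.S (b v u))
    with hΨ
  set P₁ := matrix₄ (fun x y z w => D.φ (x ⊗ₜ[k] (y ⊗ₜ[k] D.mul (z ⊗ₜ[k] w)))) a b
    (fun u v => D.S (b v u)) b with hP₁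
  set P₂ := matrix₄ (fun x y z w => D.φ (D.mul (x ⊗ₜ[k] y) ⊗ₜ[k] (z ⊗ₜ[k] w))) a b
    (fun u v => D.S (b v u)) b with hP₂
  set P₃ := matrix₄ (fun x y z w => D.counit x * D.φ (y ⊗ₜ[k] (z ⊗ₜ[k] w))) a b
    (fun u v => D.S (b v u)) b with hP₃
  set P₄ := matrix₄ (fun x y z w => D.φ (x ⊗ₜ[k] (D.mul (y ⊗ₜ[k] z) ⊗ₜ[k] w))) a b
    (fun u v => D.S (b v u)) b with hP₄
  set P₅ := matrix₄ (fun x y z w => D.counit w * D.φ (x ⊗ₜ[k] (y ⊗ₜ[k] z))) a b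
    (fun u v => D.S (b v u)) b with hP₅
  obtain ⟨V, hV⟩ : ∃ V, Ψ.mulVec (D.colβ b j) = V := ⟨_, rfl⟩
  rw [hV]
  let R : I × J × J × J → k :=
    fun y => if i = y.1 then if p = y.2.1 then D.α (b y.2.2.1 y.2.2.2) else 0 else 0
  let C : I × J × J × J → k :=
    fun y => if y.2.2.2 = q then V (y.1, y.2.1, y.2.2.1) else 0
  let B : I × J × J × J → k :=
    fun y => if y.2.2.2 = q then if y.1 = j then D.β (b y.2.1 y.2.2.1) else 0 else 0
  -- The `α` axiom turns the product in the last slot of `φ` into `1`, and `φ(·, ·, 1)` is trivial.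
  have hR : Matrix.vecMul R P₁ = R := by
    ext ⟨m, r, v, w⟩
    have h := congrArg (fun z => D.φ (a i m ⊗ₜ[k] (b p r ⊗ₜ[k] z))) (D.antipode_α hb v w)
    simp only [TensorProduct.tmul_sum, map_sum, TensorProduct.tmul_smul, map_smul,
      D.φ_right_one ha hb, smul_eq_mul] at h
    simp only [Matrix.vecMul, dotProduct, R, hP₁, matrix₄, Fintype.sum_prod_type]
    simp only [Matrix.of_apply, ite_mul, zero_mul, Fintype.sum_ite_eq, Finset.sum_ite_irrel,
      Finset.sum_const_zero, h, Matrix.one_apply]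
    by_cases h : i = m <;> simp [h]
  -- `C` contains `φ⁻¹` applied to the `β` column, so `φ` cancels it.
  have hC : P₅.mulVec C = B := by
    have h : (matrix₃ (fun x y z => D.φ (x ⊗ₜ[k] (y ⊗ₜ[k] z))) a b
        (fun u v => D.S (b v u))).mulVec V = D.colβ b j := by
      rw [← hV, Matrix.mulVec_mulVec, D.φ_mul_φInv ha hb hs, Matrix.one_mulVec]
    ext ⟨m, r, t, w⟩
    have h' := congrFun h (m, r, t)
    simp only [Matrix.mulVec, dotProduct, matrix₃, Fintype.sum_prod_type, Matrix.of_apply] at h'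
    simp only [Matrix.mulVec, dotProduct, B, C, hP₅, matrix₄, Fintype.sum_prod_type,
      hb.counit, Matrix.of_apply]
    simp [Matrix.one_apply, h', colβ]
  -- The `β` axiom puts `1` in the middle slot of `φ`.
  have hB : P₄.mulVec B = B := by
    ext ⟨m, r, t, w⟩
    have h := congrArg (fun z => D.φ (a m j ⊗ₜ[k] (z ⊗ₜ[k] b w q))) (D.antipode_β hb r t)
    simp only [TensorProduct.tmul_sum, TensorProduct.sum_tmul, map_sum, TensorProduct.tmul_smul,
      ← TensorProduct.smul_tmul', map_smul, D.φ_one, smul_eq_mul, ha.counit, hb.counit] at h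
    simp only [Matrix.mulVec, dotProduct, B, hP₄, matrix₄, Fintype.sum_prod_type]
    simp only [mul_comm (D.β _)] at h
    simp [h, Matrix.one_apply]
  have hl : D.rowα b (i, p) ⬝ᵥ (matrix₃ (fun x y z => D.φ (x ⊗ₜ[k] (y ⊗ₜ[k] z)))
      (fun x y : I × J => D.mul (a x.1 y.1 ⊗ₜ[k] b x.2 y.2)) (fun u v => D.S (b v u)) b).mulVec
      (fun x => if x.2.2 = q then V (x.1.1, x.1.2, x.2.1) else 0) =
      R ⬝ᵥ P₂.mulVec C := by
    -- The product comatrix of `a` and `b` is indexed by pairs, so the triple with first index in `I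
    -- × J` has to be read as a quadruple.
    refine Fintype.sum_equiv (Equiv.prodAssoc I J (J × J)) _ _ fun x => ?_
    congr 1
    · simp [rowα, R, Prod.ext_iff, ite_and]
    · exact Fintype.sum_equiv (Equiv.prodAssoc I J (J × J)) _ _ fun y => rfl
  rw [hl, ← hR, ← Matrix.dotProduct_mulVec, Matrix.mulVec_mulVec, hp, ← Matrix.mulVec_mulVec,
    hC, ← Matrix.mulVec_mulVec, hB]
  have h := D.antipode_φ hb p q
  simp [R, B, hP₃, matrix₄, dotProduct, Matrix.mulVec, Fintype.sum_prod_type, ha.counit, ← h,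
    Finset.mul_sum]
  simp only [← Fintype.sum_prod_type']
  exact Fintype.sum_equiv ⟨fun x => (x.2.2.1, x.2.2.2, x.1, x.2.1),
    fun x => (x.2.2.1, x.2.2.2, x.1, x.2.1), fun _ => rfl, fun _ => rfl⟩ _ _
    fun x => by simp only [Equiv.coe_fn_mk]; ring

end

end ComatrixQuasiHopf

namespace ComatrixQuasiHopf

variable {k : Type u} {A : Type v} [Field k] [AddCommGroup A] [Module k A]
  (D : ComatrixQuasiHopf k A)

section

variable {I J : Type} [Fintype I] [DecidableEq I] [Fintype J] [DecidableEq J]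
  {a : I → I → A} {b : J → J → A}

/-- The analogue of `∑ (x y₁) S(y₂) = ε(y) x`. The coefficients `κ` do not depend on `i`, `p`, `q`,
so they can be taken out of sums over these indices. -/
theorem exists_sum_quasiMulAntipode_eq (ha : IsComatrix D.comul D.counit a)
    (hb : IsComatrix D.comul D.counit b) (j : I) :
    ∃ κ : I × J × J → k, ∀ i p q, ∑ x, κ x • D.quasiMulAntipode
      (D.mul (a i x.1 ⊗ₜ[k] b p x.2.1) ⊗ₜ[k] b x.2.2 q) = (1 : Matrix J J k) p q • a i j := by
  have hs := D.isComatrix_S hb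
  set Ψ := matrix₃ (fun x y z => D.φInv (x ⊗ₜ[k] (y ⊗ₜ[k] z))) a b (fun u v => D.S (b v u))
    with hΨ
  -- The coefficients are those of `φ⁻¹(x, y, S(z))` contracted with `β`, as in the column of
  -- `rowα_dotProduct_pentagon`.
  refine ⟨Ψ.mulVec (D.colβ b j), fun i p q => ?_⟩
  rw [← sub_eq_zero, ← Module.forall_dual_apply_eq_zero_iff k]
  intro f
  rw [map_sub, sub_eq_zero]
  have hinv := D.φ_mul_φInv ha hb hs
  have hinv' := mul_eq_one_comm.mp hinv
  have hq := D.quasi_assoc f ha hb hs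
  rw [← hΨ] at hinv hinv'
  -- Quasi-associativity conjugated by `φ⁻¹`; it lets the matrix of `f` pass through `Ψ` and reach
  -- the `β` column, where `mulVec_colβ` evaluates it.
  have hF : matrix₃ (fun x y z => f (D.mul (D.mul (x ⊗ₜ[k] y) ⊗ₜ[k] z))) a b
      (fun u v => D.S (b v u)) * Ψ =
      Ψ * matrix₃ (fun x y z => f (D.mul (x ⊗ₜ[k] D.mul (y ⊗ₜ[k] z)))) a b
        (fun u v => D.S (b v u)) := by
    have := congrArg (fun P => Ψ * P * Ψ) hq
    simp only [← mul_assoc, hinv', _root_.one_mul] at this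
    rw [mul_assoc _ _ Ψ, hinv, _root_.mul_one] at this
    exact this.symm
  have hab := D.isComatrix_mul ha hb
  have h1 : ∀ x : I × J × J, f (D.quasiMulAntipode
      (D.mul (a i x.1 ⊗ₜ[k] b p x.2.1) ⊗ₜ[k] b x.2.2 q)) = _ := fun x =>
    D.apply_quasiMulAntipode hab hb f (i, p) (x.1, x.2.1) x.2.2 q
  simp only [map_sum, map_smul, h1, ← dotProduct_smul, ← Matrix.mulVec_smul]
  rw [← dotProduct_sum, ← Matrix.mulVec_sum]
  have h2 : ∑ x : I × J × J, Ψ.mulVec (D.colβ b j) x • (fun y : (I × J) × J × J =>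
      if y.2.2 = q then f (D.mul (D.mul (a y.1.1 x.1 ⊗ₜ[k] b y.1.2 x.2.1) ⊗ₜ[k]
        D.S (b x.2.2 y.2.1))) else 0) =
      ∑ l, f (a l j) • fun y : (I × J) × J × J => if y.2.2 = q then
        Ψ.mulVec (D.colβ b l) (y.1.1, y.1.2, y.2.1) else 0 := by
    have h3 : (matrix₃ (fun x y z => f (D.mul (D.mul (x ⊗ₜ[k] y) ⊗ₜ[k] z))) a b
      (fun u v => D.S (b v u))).mulVec (Ψ.mulVec (D.colβ b j)) =
        ∑ l, f (a l j) • Ψ.mulVec (D.colβ b l) := by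
      rw [Matrix.mulVec_mulVec, hF, ← Matrix.mulVec_mulVec, D.mulVec_colβ hb, Matrix.mulVec_sum]
      simp only [Matrix.mulVec_smul]
    ext ⟨⟨m, r⟩, u, t⟩
    have h4 := congrFun h3 (m, r, u)
    by_cases ht : t = q
    · simp only [Finset.sum_apply, Pi.smul_apply, ht, if_true]
      simp only [Finset.sum_apply, Pi.smul_apply] at h4
      rw [← h4]
      exact Finset.sum_congr rfl fun x _ => mul_comm _ _
    · simp [ht]
  have h5 := fun l => D.rowα_dotProduct_pentagon ha hb i l p q
  simp only [← hΨ] at h5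
  rw [h2, Matrix.mulVec_sum, dotProduct_sum]
  simp only [Matrix.mulVec_smul, dotProduct_smul, h5]
  simp [Matrix.one_apply]

end

/-! ### Integrals and functionals with finite-rank translation -/

theorem hit_sum {ι : Type*} (s : Finset ι) (f : ι → Module.Dual k A) (x : A) :
    hit D.comul (∑ i ∈ s, f i) x = ∑ i ∈ s, hit D.comul (f i) x := by
  simp only [hit, LinearMap.comp_apply, LinearEquiv.coe_coe]
  generalize D.comul x = t
  induction t with
  | zero => simp
  | add y z hy hz => simp only [map_add, hy, hz, Finset.sum_add_distrib]
  | tmul y z => simp [Finset.sum_smul]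

theorem hit_smul (c : k) (f : Module.Dual k A) (x : A) :
    hit D.comul (c • f) x = c • hit D.comul f x := by
  simp [hit, LinearMap.lTensor_smul]

/-- `T` is a left integral: `∑ x₁ T(x₂) = T(x) 1`. -/
def IsLeftIntegral (T : Module.Dual k A) : Prop :=
  ∀ x, hit D.comul T x = T x • D.one

/-- Each `Tᵢ = ∑ⱼ θⱼ(· ∘ cᵢⱼ)` is a left integral: `hit_twist` brings in a second factor of `c`,
which `hθ` contracts to `1`. If every `Tᵢ` vanished, each `θᵢ` could be recovered as zero. -/
theorem exists_isLeftIntegral_of_column {J : Type} [Fintype J] [DecidableEq J] {c : J → J → A}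
    (hc : IsComatrix D.comul D.counit c) (θ : J → Module.Dual k A)
    (hθ : ∀ i x, ∑ j, D.mul (hit D.comul (θ j) x ⊗ₜ[k] c i j) = θ i x • D.one)
    (hne : ∃ i, θ i ≠ 0) : ∃ T, T ≠ 0 ∧ D.IsLeftIntegral T := by
  by_contra! hno
  have hint : ∀ i, D.IsLeftIntegral (∑ j, D.twist (θ j) (c i j)) := by
    intro i x
    simp only [D.hit_sum, D.hit_twist hc]
    rw [Finset.sum_comm]
    simp only [hθ, LinearMap.sum_apply, twist_apply, Finset.sum_smul]
  have hzero : ∀ i, ∑ j, D.twist (θ j) (c i j) = 0 := fun i => by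
    by_contra h
    exact hno _ h (hint i)
  obtain ⟨p, hp⟩ := hne
  refine hp (D.ext_comatrix fun n a ha i j => ?_)
  obtain ⟨κ, hκ⟩ := D.exists_sum_quasiMulAntipode_eq ha hc j
  -- The left side is `θₚ(aᵢⱼ)`; expanding it with `κ` writes it as a combination of values of the
  -- vanishing integrals.
  have h : ∑ q, θ q ((1 : Matrix J J k) p q • a i j) = 0 := by
    simp only [← hκ i p, map_sum, map_smul]
    rw [Finset.sum_comm]
    refine Finset.sum_eq_zero fun x _ => ?_
    rw [← Finset.smul_sum]
    have := LinearMap.congr_fun (hzero x.2.2) (D.mul (a i x.1 ⊗ₜ[k] c p x.2.1))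
    simp only [LinearMap.sum_apply, twist_apply, LinearMap.zero_apply] at this
    rw [this, smul_zero]
  simp only [map_smul] at h
  simpa [Matrix.one_apply] using h

/-- The image `V` of `f ⇀ ·` is a left coideal. For a basis `e` of `V` with coordinates `ψ`, the `a
i j = ψⱼ ⇀ eᵢ` are its matrix coefficients and `p j = ψⱼ(f ⇀ ·)`; the preimages `x i` of the basis
vectors make the `p j` independent. -/
theorem exists_comatrix_of_finite_range_hit (f : Module.Dual k A)
    [Module.Finite k (LinearMap.range (hit D.comul f))] (hf : f ≠ 0) :
    ∃ (n : ℕ) (a : Fin n → Fin n → A) (p : Fin n → Module.Dual k A) (x : Fin n → A), 0 < n ∧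
      IsComatrix D.comul D.counit a ∧ (∀ i j, p j (x i) = (1 : Matrix _ _ k) i j) ∧
      ∀ j y, hit D.comul (p j) y = ∑ i, p i y • a i j := by
  set V := LinearMap.range (hit D.comul f) with hV
  let e := Module.finBasis k V
  have hψ : ∀ j, ∃ ψ : Module.Dual k A, ψ ∘ₗ V.subtype = e.coord j := fun j =>
    LinearMap.exists_extend _
  choose ψ hψ using hψ
  have hx : ∀ i, ∃ x, hit D.comul f x = (e i : A) := fun i => (e i).2
  choose x hx using hx
  have hψv : ∀ j (v : V), ψ j v = e.repr v j := fun j v => LinearMap.congr_fun (hψ j) v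
  have hsum : ∀ y, hit D.comul f y = ∑ i, ψ i (hit D.comul f y) • (e i : A) := fun y => by
    have h := congrArg Subtype.val (e.sum_repr ⟨hit D.comul f y, y, rfl⟩)
    simp only [AddSubmonoidClass.coe_finsetSum, Submodule.coe_smul] at h
    rw [← h]
    exact Finset.sum_congr rfl fun i _ => by rw [← hψv, h]
  have hp : ∀ j y, hit D.comul (ψ j ∘ₗ hit D.comul f) y =
      ∑ i, ψ i (hit D.comul f y) • hit D.comul (ψ j) (e i : A) := fun j y => by
    rw [D.hit_comp_hit, LinearMap.comp_apply]
    conv_lhs => rw [hsum y]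
    simp
  have hψe : ∀ i j, ψ j (e i) = (1 : Matrix _ _ k) i j := fun i j => by
    rw [hψv, e.repr_self, Finsupp.single_apply, Matrix.one_apply]
  refine ⟨_, fun i j => hit D.comul (ψ j) (e i), fun j => ψ j ∘ₗ hit D.comul f, x, ?_,
    ⟨fun i j => ?_, fun i j => ?_⟩, fun i j => ?_, hp⟩
  · have : Nontrivial V := by
      obtain ⟨y, hy⟩ := DFunLike.ne_iff.mp hf
      refine ⟨⟨⟨hit D.comul f y, y, rfl⟩, 0, fun h => hy ?_⟩⟩
      rw [← D.counit_hit, show hit D.comul f y = 0 from congrArg Subtype.val h]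
      simp
    exact Module.finrank_pos
  · have hmap : hit D.comul (ψ j) ∘ₗ hit D.comul f =
        ∑ l, (ψ l ∘ₗ hit D.comul f).smulRight (hit D.comul (ψ j) (e l)) := by
      ext y
      simpa [D.hit_comp_hit] using hp j y
    have ht : ∀ t, (hit D.comul (ψ j) ∘ₗ hit D.comul f).lTensor A t =
        ∑ l, (TensorProduct.rid k A ((ψ l ∘ₗ hit D.comul f).lTensor A t)) ⊗ₜ[k]
          hit D.comul (ψ j) (e l) := by
      intro t
      rw [hmap]
      induction t with
      | zero => simp
      | add y z hy hz =>
        simp only [map_add, hy, hz, Finset.sum_add_distrib, TensorProduct.add_tmul]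
      | tmul y z => simp [TensorProduct.tmul_sum, TensorProduct.smul_tmul]
    rw [D.comul_hit, ← hx, D.comul_hit, ← LinearMap.comp_apply, ← LinearMap.lTensor_comp, ht]
    refine Finset.sum_congr rfl fun l _ => ?_
    rw [hx i]
    congr 1
    rw [← hx i]
    exact LinearMap.congr_fun (D.hit_comp_hit _ _) _
  · exact (D.counit_hit _ _).trans (hψe i j)
  · simp only [LinearMap.comp_apply, hx, hψe]

/-- For `θᵢ = ∑ⱼ β(aⱼᵢ) pⱼ` and the comatrix `S(aⱼᵢ)`, the column condition is the `β` axiom. -/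
theorem exists_isLeftIntegral_of_finite_range_hit (f : Module.Dual k A)
    [Module.Finite k (LinearMap.range (hit D.comul f))] (hf : f ≠ 0) :
    ∃ T, T ≠ 0 ∧ D.IsLeftIntegral T := by
  obtain ⟨n, a, p, x, hn, ha, hpx, hp⟩ := D.exists_comatrix_of_finite_range_hit f hf
  refine D.exists_isLeftIntegral_of_column (D.isComatrix_S ha)
    (fun i => ∑ j, D.β (a j i) • p j) (fun i y => ?_) ?_
  · have h : ∀ m, ∑ j, ∑ l, D.β (a l j) • D.mul (a m l ⊗ₜ[k] D.S (a j i)) =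
        D.β (a m i) • D.one := fun m => by
      rw [Finset.sum_comm]
      exact D.antipode_β ha m i
    simp only [D.hit_sum, D.hit_smul, hp, TensorProduct.sum_tmul, map_sum,
      ← TensorProduct.smul_tmul', map_smul, LinearMap.sum_apply, LinearMap.smul_apply,
      Finset.smul_sum, Finset.sum_smul, smul_assoc, smul_comm _ (p _ y)]
    have h' : ∀ m, p m y • ∑ j, ∑ l, D.β (a l j) • D.mul (a m l ⊗ₜ[k] D.S (a j i)) =
      p m y • D.β (a m i) • D.one := fun m => by rw [h]
    simp only [Finset.smul_sum] at h'
    simp only [← h']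
    rw [Finset.sum_comm (f := fun m j => ∑ l, p m y • D.β (a l j) • D.mul (a m l ⊗ₜ[k] D.S (a j i)))]
    exact Finset.sum_congr rfl fun j _ => Finset.sum_comm
  -- Evaluating at the dual vectors `x i` would give `β(aᵢⱼ) = 0` throughout, against `antipode_φ`
  -- at a diagonal entry; this is where `0 < n` enters.
  · by_contra! h
    have hβ : ∀ i j, D.β (a i j) = 0 := fun i j => by
      have := LinearMap.congr_fun (h j) (x i)
      simpa [hpx, Matrix.one_apply] using this
    have := D.antipode_φ ha ⟨0, hn⟩ ⟨0, hn⟩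
    simp [hβ] at this

/-- Both sides of `hit_twist` at `x = aᵢⱼ` are expanded for an integral `T`. One is the translate of
`y` by `gᵢ = T(aᵢⱼ ∘ ·)` on the opposite side, the other a combination of the finitely many entries
`aᵢₘ`. -/
theorem exists_finite_range_hit_mirror {T : Module.Dual k A} (hT : D.IsLeftIntegral T)
    (hne : T ≠ 0) : ∃ g : Module.Dual k A, g D.one ≠ 0 ∧
      Module.Finite k (LinearMap.range (hit D.mirror.comul g)) := by
  obtain ⟨n, a, ha, i, j, hij⟩ : ∃ (n : ℕ) (a : Fin n → Fin n → A),
      IsComatrix D.comul D.counit a ∧ ∃ i j, T (a i j) ≠ 0 := by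
    by_contra! h
    exact hne (D.ext_comatrix fun n a ha i j => h n a ha i j)
  let g : Fin n → Module.Dual k A := fun m =>
    T ∘ₗ D.quasiMulAntipode ∘ₗ TensorProduct.mk k A A (a m j)
  have hg : hit D.mirror.comul (g i) = ∑ m, (g m).smulRight (a i m) := by
    refine D.ext_comatrix fun N b hb p q => ?_
    have h1 := (hb.transpose).hit_apply (g i) q p
    have h2 := D.hit_twist hb T p q (a i j)
    rw [ha.hit_apply] at h2
    simp only [hT _, ← TensorProduct.smul_tmul', map_smul, D.one_mul] at h2
    change hit ((TensorProduct.comm k A A).toLinearMap ∘ₗ D.comul) (g i) (b p q) = _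
    simpa [g] using h1.trans h2.symm
  refine ⟨g i, ?_, ?_⟩
  -- Since `x ∘ 1 = α(1) x`, the value at `1` is `α(1) T(aᵢⱼ)`.
  · have h := D.quasiMulAntipode_apply ha D.isComatrix_one i j () ()
    have h' : D.quasiMulAntipode (a i j ⊗ₜ[k] D.one) = D.α D.one • a i j := by
      rw [h]
      simp [D.S_one, D.φ_one, D.mul_one, D.counit_one, ha.counit, Matrix.one_apply]
    simpa [g, h', D.α_one_ne_zero] using hij
  · have : LinearMap.range (hit D.mirror.comul (g i)) ≤ Submodule.span k (Set.range (a i)) := by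
      rintro _ ⟨y, rfl⟩
      rw [hg]
      simp only [LinearMap.sum_apply, LinearMap.smulRight_apply]
      exact Submodule.sum_mem _ fun m _ => Submodule.smul_mem _ _ (Submodule.subset_span ⟨m, rfl⟩)
    have := Module.Finite.span_of_finite k (Set.finite_range (a i))
    exact Submodule.finiteDimensional_of_le ‹_›

end ComatrixQuasiHopf

/-! ### Every coalgebra is spanned by comatrices -/

section Coalgebra

variable {k : Type u} {A : Type v} [Field k] [AddCommGroup A] [Module k A] [Coalgebra k A]

namespace IsComatrix

variable {I J : Type*} [Fintype I] [DecidableEq I] [Fintype J] [DecidableEq J]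
  {a : I → I → A}

theorem tmul {C : Type*} [AddCommGroup C] [Module k C] [Coalgebra k C] {c : J → J → C}
    (ha : IsComatrix (Coalgebra.comul (R := k)) Coalgebra.counit a)
    (hc : IsComatrix (Coalgebra.comul (R := k)) Coalgebra.counit c) :
    IsComatrix (Coalgebra.comul (R := k)) Coalgebra.counit
      (fun x y : I × J => a x.1 y.1 ⊗ₜ[k] c x.2 y.2) where
  comul x y := by
    simp [ha.comul, hc.comul, TensorProduct.comul_tmul, TensorProduct.sum_tmul,
      TensorProduct.tmul_sum, Fintype.sum_prod_type]
    exact Finset.sum_comm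
  counit x y := by
    simp [ha.counit, hc.counit, Matrix.one_apply, Prod.ext_iff, ite_and]

theorem map {C : Type*} [AddCommGroup C] [Module k C] [Coalgebra k C]
    (ha : IsComatrix (Coalgebra.comul (R := k)) Coalgebra.counit a) (f : A →ₗc[k] C) :
    IsComatrix (Coalgebra.comul (R := k)) Coalgebra.counit (fun i j => f (a i j)) where
  comul i j := by
    rw [← CoalgHomClass.map_comp_comul_apply, ha.comul]
    simp
  counit i j := by rw [CoalgHomClass.counit_comp_apply, ha.counit]

theorem convMul_apply (ha : IsComatrix (Coalgebra.comul (R := k)) Coalgebra.counit a)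
    (f g : WithConv (Module.Dual k A)) (i j : I) :
    (f * g) (a i j) = ∑ l, f (a i l) * g (a l j) := by
  rw [LinearMap.convMul_apply, ha.comul]
  simp

end IsComatrix

theorem comul_rightHit (f : Module.Dual k A) (x : A) :
    Coalgebra.comul (R := k) (rightHit f x) = (rightHit f).rTensor A (Coalgebra.comul x) := by
  have h : ∀ t : A ⊗[k] A, Coalgebra.comul (R := k) (TensorProduct.lid k A (f.rTensor A t)) =
      ((TensorProduct.lid k A).toLinearMap ∘ₗ f.rTensor A).rTensor A
        ((TensorProduct.assoc k A A A).symm ((Coalgebra.comul (R := k)).lTensor A t)) := by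
    intro t
    induction t with
    | zero => simp
    | add y z hy hz => simp only [map_add, hy, hz]
    | tmul y z =>
      simp only [LinearMap.rTensor_tmul, TensorProduct.lid_tmul, map_smul, LinearMap.lTensor_tmul]
      generalize Coalgebra.comul (R := k) z = s
      induction s with
      | zero => simp
      | add y z hy hz => simp only [smul_add, TensorProduct.tmul_add, map_add, hy, hz]
      | tmul y z => simp [TensorProduct.smul_tmul']
  refine (h _).trans ?_
  rw [Coalgebra.coassoc_symm_apply, ← LinearMap.comp_apply, ← LinearMap.rTensor_comp]
  rfl

theorem comul_leftHit (f : Module.Dual k A) (x : A) :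
    Coalgebra.comul (R := k) (leftHit f x) = (leftHit f).lTensor A (Coalgebra.comul x) := by
  have h : ∀ t : A ⊗[k] A, Coalgebra.comul (R := k) (TensorProduct.rid k A (f.lTensor A t)) =
      ((TensorProduct.rid k A).toLinearMap ∘ₗ f.lTensor A).lTensor A
        (TensorProduct.assoc k A A A ((Coalgebra.comul (R := k)).rTensor A t)) := by
    intro t
    induction t with
    | zero => simp
    | add y z hy hz => simp only [map_add, hy, hz]
    | tmul y z =>
      simp only [LinearMap.lTensor_tmul, TensorProduct.rid_tmul, map_smul, LinearMap.rTensor_tmul]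
      generalize Coalgebra.comul (R := k) y = s
      induction s with
      | zero => simp
      | add y z hy hz => simp only [smul_add, TensorProduct.add_tmul, map_add, hy, hz]
      | tmul y z => simp
  refine (h _).trans ?_
  rw [Coalgebra.coassoc_apply, ← LinearMap.comp_apply, ← LinearMap.lTensor_comp]
  rfl

theorem apply_rightHit (f g : Module.Dual k A) (x : A) : g (rightHit f x) = f (leftHit g x) := by
  simp only [rightHit, leftHit, LinearMap.comp_apply, LinearEquiv.coe_coe]
  generalize Coalgebra.comul (R := k) x = t
  induction t with
  | zero => simp
  | add y z hy hz => simp only [map_add, hy, hz]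
  | tmul y z => simp [mul_comm]

theorem counit_leftHit (f : Module.Dual k A) (x : A) :
    Coalgebra.counit (R := k) (leftHit f x) = f x := by
  rw [← apply_rightHit]
  simp [rightHit, Coalgebra.rTensor_counit_comul]

theorem leftHit_counit (x : A) : leftHit (Coalgebra.counit (R := k)) x = x := by
  simp [leftHit, Coalgebra.lTensor_counit_comul]

/-- A form of local finiteness: the space `V` of all `x ↼ f` is a finite-dimensional left coideal
containing `x`, and the counit writes its vectors in terms of its matrix coefficients. -/
theorem exists_isComatrix_span (x : A) : ∃ (n : ℕ) (a : Fin n → Fin n → A),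
    IsComatrix (Coalgebra.comul (R := k)) Coalgebra.counit a ∧
    x ∈ Submodule.span k (Set.range fun p : Fin n × Fin n => a p.1 p.2) := by
  let ρ : Module.Dual k A →ₗ[k] A :=
    { toFun := fun f => rightHit f x
      map_add' := fun f g => by simp [rightHit, LinearMap.rTensor_add]
      map_smul' := fun c f => by simp [rightHit, LinearMap.rTensor_smul] }
  have hfin : Module.Finite k (LinearMap.range ρ) := by
    have h : ∀ t : A ⊗[k] A, ∃ W : Submodule k A, Module.Finite k W ∧
        ∀ f : Module.Dual k A, TensorProduct.lid k A (f.rTensor A t) ∈ W := by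
      intro t
      induction t with
      | zero => exact ⟨⊥, inferInstance, fun f => by simp⟩
      | add y z hy hz =>
        obtain ⟨W, hW, hy⟩ := hy
        obtain ⟨W', hW', hz⟩ := hz
        refine ⟨W ⊔ W', inferInstance, fun f => ?_⟩
        rw [map_add, map_add]
        exact Submodule.add_mem_sup (hy f) (hz f)
      | tmul y z =>
        refine ⟨Submodule.span k {z}, inferInstance, fun f => ?_⟩
        simpa using Submodule.smul_mem _ _ (Submodule.mem_span_singleton_self z)
    obtain ⟨W, hW, h⟩ := h (Coalgebra.comul x)
    refine Submodule.finiteDimensional_of_le (S₂ := W) ?_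
    rintro _ ⟨f, rfl⟩
    exact h f
  set V := LinearMap.range ρ with hV
  let e := Module.finBasis k V
  have hψ : ∀ j, ∃ ψ : Module.Dual k A, ψ ∘ₗ V.subtype = e.coord j := fun j =>
    LinearMap.exists_extend _
  choose ψ hψ using hψ
  have hψv : ∀ j (v : V), ψ j v = e.repr v j := fun j v => LinearMap.congr_fun (hψ j) v
  have hsum : ∀ v ∈ V, v = ∑ i, ψ i v • (e i : A) := fun v hv => by
    have h := congrArg Subtype.val (e.sum_repr ⟨v, hv⟩)
    simp only [AddSubmonoidClass.coe_finsetSum, Submodule.coe_smul] at h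
    conv_lhs => rw [← h]
    exact Finset.sum_congr rfl fun i _ => by rw [← hψv]
  have hmem : ∀ v ∈ V, ∀ g : Module.Dual k A, rightHit g v ∈ V := by
    rintro _ ⟨f, rfl⟩ g
    refine ⟨g ∘ₗ rightHit f, ?_⟩
    change rightHit _ x = rightHit g (rightHit f x)
    conv_rhs => rw [rightHit, LinearMap.comp_apply, LinearMap.comp_apply, comul_rightHit,
      ← LinearMap.comp_apply (LinearMap.rTensor A g), ← LinearMap.rTensor_comp]
    rfl
  have hcomul : ∀ v ∈ V, Coalgebra.comul (R := k) v = ∑ j, leftHit (ψ j) v ⊗ₜ[k] (e j : A) := by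
    intro v hv
    classical
    -- A tensor is determined by its coordinates in the left factor. Those of `Δ(v)` are `v ↼
    -- b.coord i`, which lie in `V` and can be expanded in `e`.
    let b := Module.Basis.ofVectorSpace k A
    apply (TensorProduct.equivFinsuppOfBasisLeft (N := A) b).injective
    ext i
    rw [TensorProduct.equivFinsuppOfBasisLeft_apply, TensorProduct.equivFinsuppOfBasisLeft_apply]
    refine (hsum _ (hmem v hv (b.coord i))).trans ?_
    simp only [map_sum, LinearMap.rTensor_tmul, TensorProduct.lid_tmul, apply_rightHit]
  refine ⟨_, fun i j => leftHit (ψ j) (e i), ⟨fun i j => ?_, fun i j => ?_⟩, ?_⟩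
  · rw [comul_leftHit, hcomul _ (e i).2]
    simp
  · rw [counit_leftHit, hψv, e.repr_self, Finsupp.single_apply, Matrix.one_apply]
  · have hx : x ∈ V := by
      refine ⟨Coalgebra.counit, ?_⟩
      change rightHit _ x = x
      simp [rightHit, Coalgebra.rTensor_counit_comul]
    rw [hsum x hx]
    refine Submodule.sum_mem _ fun i _ => Submodule.smul_mem _ _ ?_
    have h : (e i : A) = ∑ j, Coalgebra.counit (R := k) (e j : A) • leftHit (ψ j) (e i) := by
      conv_lhs => rw [← leftHit_counit (k := k) (e i : A), leftHit, LinearMap.comp_apply,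
        LinearMap.comp_apply, hcomul _ (e i).2]
      simp
    rw [h]
    exact Submodule.sum_mem _ fun j _ => Submodule.smul_mem _ _ (Submodule.subset_span ⟨(i, j), rfl⟩)

end Coalgebra

/-! ### From the coalgebra axioms to matrix identities -/

namespace DualQuasiHopfAlgebra

variable {k : Type u} {A : Type v} [Field k] [AddCommGroup A] [Module k A] [Coalgebra k A]

/-- The comatrix description of a dual quasi-Hopf algebra. -/
def toComatrixQuasiHopf (H : DualQuasiHopfAlgebra k A) : ComatrixQuasiHopf k A where
  comul := Coalgebra.comul
  counit := Coalgebra.counit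
  mul := H.M.toLinearMap
  one := H.u 1
  φ := H.φ
  φInv := H.φInv
  S := H.S
  α := H.α
  β := H.β
  span_comatrix := exists_isComatrix_span
  isComatrix_one := by
    have h : IsComatrix (Coalgebra.comul (R := k)) Coalgebra.counit
        (fun _ _ : Unit => (1 : k)) := ⟨fun _ _ => by simp, fun _ _ => by simp⟩
    exact h.map H.u
  isComatrix_mul ha hb := (ha.tmul hb).map H.M
  isComatrix_S := by
    intro I _ _ a ha
    have hc := fun x => LinearMap.congr_fun H.comul_S x
    have hε := fun x => LinearMap.congr_fun H.counit_S x
    simp only [LinearMap.comp_apply, LinearEquiv.coe_coe] at hc hε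
    refine ⟨fun i j => ?_, fun i j => ?_⟩
    · rw [hc, ha.comul]
      simp
    · rw [hε, ha.counit, ← Matrix.transpose_apply (1 : Matrix I I k), Matrix.transpose_one]
  one_mul := H.one_mul
  mul_one := H.mul_one
  φ_one := H.φ_one
  φ_mul_φInv := by
    intro I J K _ _ _ _ _ _ a b c ha hb hc
    have h := ha.tmul (hb.tmul hc)
    ext x y
    have := h.convMul_apply (toConv H.φ) (toConv H.φInv) x y
    rw [H.φ_mul_φInv] at this
    exact this.symm.trans (h.counit x y)
  quasi_assoc := by
    intro f I J K _ _ _ _ _ _ a b c ha hb hc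
    have h := ha.tmul (hb.tmul hc)
    ext x y
    have h' := congrArg f (LinearMap.congr_fun H.quasi_assoc
      (a x.1 y.1 ⊗ₜ[k] (b x.2.1 y.2.1 ⊗ₜ[k] c x.2.2 y.2.2)))
    have hx := h.comul x y
    simp only [LinearMap.comp_apply, hx, map_sum, TensorProduct.map_tmul, LinearEquiv.coe_coe,
      TensorProduct.rid_tmul, TensorProduct.lid_tmul, map_smul] at h'
    rw [Matrix.mul_apply, Matrix.mul_apply]
    exact (Finset.sum_congr rfl fun l _ => mul_comm _ _).trans h'
  pentagon := by
    intro I J K L _ _ _ _ _ _ _ _ a b c d ha hb hc hd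
    have h := ha.tmul (hb.tmul (hc.tmul hd))
    let E : WithConv (Module.Dual k (A ⊗[k] (A ⊗[k] (A ⊗[k] A)))) →
        Matrix (I × J × K × L) (I × J × K × L) k := fun f => Matrix.of fun x y =>
      f (a x.1 y.1 ⊗ₜ[k] (b x.2.1 y.2.1 ⊗ₜ[k] (c x.2.2.1 y.2.2.1 ⊗ₜ[k] d x.2.2.2 y.2.2.2)))
    have hE : ∀ f g, E (f * g) = E f * E g := fun f g => by
      ext x y
      exact h.convMul_apply f g x y
    have h' := congrArg E H.cocycle
    rw [hE, hE, hE] at h'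
    have e₃ : matrix₄ (fun x y z w => Coalgebra.counit (R := k) x *
        H.φ (y ⊗ₜ[k] (z ⊗ₜ[k] w))) a b c d = E (toConv (H.φ ∘ₗ
          (TensorProduct.lid k (A ⊗[k] (A ⊗[k] A))).toLinearMap ∘ₗ
          (Coalgebra.counit (R := k) (A := A)).rTensor (A ⊗[k] (A ⊗[k] A)))) := by
      ext x y
      simp [E, matrix₄]
    have e₅ : matrix₄ (fun x y z w => Coalgebra.counit (R := k) w *
        H.φ (x ⊗ₜ[k] (y ⊗ₜ[k] z))) a b c d = E (toConv (H.φ ∘ₗ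
          (((TensorProduct.rid k A).toLinearMap ∘ₗ
          (Coalgebra.counit (R := k) (A := A)).lTensor A).lTensor A).lTensor A)) := by
      ext x y
      simp [E, matrix₄]
    rw [e₃, e₅]
    exact h'
  antipode_α := by
    intro I _ _ a ha i j
    rw [← H.antipode_α (a i j), ha.comul]
    simp [rightHit, ha.comul, TensorProduct.tmul_sum]
  antipode_β := by
    intro I _ _ a ha i j
    rw [← H.antipode_β (a i j), ha.comul]
    simp [leftHit, ha.comul, TensorProduct.sum_tmul, ← TensorProduct.smul_tmul']
    exact Finset.sum_comm
  antipode_φ := by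
    intro I _ _ a ha i j
    rw [← ha.counit, ← H.antipode_φ (a i j)]
    simp [leftHit, rightHit, comul₃, ha.comul, TensorProduct.tmul_sum, TensorProduct.sum_tmul,
      ← TensorProduct.smul_tmul', Finset.mul_sum, mul_assoc]
    simp only [← Fintype.sum_prod_type']
    exact Fintype.sum_equiv ⟨fun x => (x.2.1, x.2.2.1, x.2.2.2, x.1),
      fun x => (x.2.2.2, x.1, x.2.1, x.2.2.1), fun _ => rfl, fun _ => rfl⟩ _ _
      fun x => mul_left_comm _ _ _

end DualQuasiHopfAlgebra

/-! ### Left and right integrals and the finite-rank criterion -/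

namespace DualQuasiHopfAlgebra

variable {k : Type u} {A : Type v} [Field k] [AddCommGroup A] [Module k A] [Coalgebra k A]
  (H : DualQuasiHopfAlgebra k A)

theorem hit_mirror_toComatrixQuasiHopf (f : Module.Dual k A) :
    hit H.toComatrixQuasiHopf.mirror.comul f = rightHit f := by
  ext x
  change TensorProduct.rid k A (f.lTensor A (TensorProduct.comm k A A (Coalgebra.comul x))) =
    TensorProduct.lid k A (f.rTensor A (Coalgebra.comul x))
  generalize Coalgebra.comul (R := k) x = t
  induction t with
  | zero => simp
  | add y z hy hz => simp only [map_add, hy, hz]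
  | tmul y z => simp

/-- `(f T)(x) = f(T ⇀ x)`, and functionals separate points. -/
theorem isLeftIntegral_iff (T : Module.Dual k A) :
    H.toComatrixQuasiHopf.IsLeftIntegral T ↔ T ∈ H.leftIntegrals := by
  have hmul : ∀ (f : Module.Dual k A) x, (toConv f * toConv T) x = f (leftHit T x) := by
    intro f x
    rw [LinearMap.convMul_apply, leftHit, LinearMap.comp_apply, LinearMap.comp_apply]
    generalize Coalgebra.comul (R := k) x = t
    induction t with
    | zero => simp
    | add y z hy hz => simp only [map_add, hy, hz]
    | tmul y z => simp [mul_comm]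
  change (∀ x, leftHit T x = T x • H.u 1) ↔ ∀ f : Module.Dual k A, _
  constructor
  · intro h f
    ext x
    rw [hmul, h]
    simp [mul_comm]
  · intro h x
    rw [← sub_eq_zero, ← Module.forall_dual_apply_eq_zero_iff k]
    intro f
    rw [map_sub, ← hmul, h f]
    simp [mul_comm]

theorem isLeftIntegral_mirror_iff (T : Module.Dual k A) :
    H.toComatrixQuasiHopf.mirror.IsLeftIntegral T ↔ T ∈ H.rightIntegrals := by
  have hmul : ∀ (f : Module.Dual k A) x, (toConv T * toConv f) x = f (rightHit T x) := by
    intro f x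
    rw [LinearMap.convMul_apply, rightHit, LinearMap.comp_apply, LinearMap.comp_apply]
    generalize Coalgebra.comul (R := k) x = t
    induction t with
    | zero => simp
    | add y z hy hz => simp only [map_add, hy, hz]
    | tmul y z => simp
  rw [ComatrixQuasiHopf.IsLeftIntegral, hit_mirror_toComatrixQuasiHopf]
  change (∀ x, rightHit T x = T x • H.u 1) ↔ ∀ f : Module.Dual k A, _
  constructor
  · intro h f
    ext x
    rw [hmul, h]
    simp [mul_comm]
  · intro h x
    rw [← sub_eq_zero, ← Module.forall_dual_apply_eq_zero_iff k]
    intro f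
    rw [map_sub, ← hmul, h f]
    simp [mul_comm]

/-- A non-zero functional whose left translates span a finite-dimensional space yields a
non-zero left integral. -/
theorem leftIntegrals_ne_bot (f : Module.Dual k A) (hf : f ≠ 0)
    (hfin : Module.Finite k (LinearMap.range (leftHit f))) : H.leftIntegrals ≠ ⊥ := by
  have : Module.Finite k (LinearMap.range (hit H.toComatrixQuasiHopf.comul f)) := hfin
  obtain ⟨T, hT, h⟩ := H.toComatrixQuasiHopf.exists_isLeftIntegral_of_finite_range_hit f hf
  exact fun hbot => hT ((Submodule.eq_bot_iff _).mp hbot T ((H.isLeftIntegral_iff T).mp h))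

theorem rightIntegrals_ne_bot (f : Module.Dual k A) (hf : f ≠ 0)
    (hfin : Module.Finite k (LinearMap.range (rightHit f))) : H.rightIntegrals ≠ ⊥ := by
  rw [← H.hit_mirror_toComatrixQuasiHopf] at hfin
  obtain ⟨T, hT, h⟩ :=
    H.toComatrixQuasiHopf.mirror.exists_isLeftIntegral_of_finite_range_hit f hf
  exact fun hbot => hT ((Submodule.eq_bot_iff _).mp hbot T
    ((H.isLeftIntegral_mirror_iff T).mp h))

theorem exists_finite_range_rightHit (h : H.leftIntegrals ≠ ⊥) : ∃ g : Module.Dual k A,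
    g (H.u 1) ≠ 0 ∧ Module.Finite k (LinearMap.range (rightHit g)) := by
  obtain ⟨T, hT, hne⟩ := Submodule.exists_mem_ne_zero_of_ne_bot h
  obtain ⟨g, hg, hfin⟩ := H.toComatrixQuasiHopf.exists_finite_range_hit_mirror
    ((H.isLeftIntegral_iff T).mpr hT) hne
  rw [H.hit_mirror_toComatrixQuasiHopf] at hfin
  exact ⟨g, hg, hfin⟩

theorem exists_finite_range_leftHit (h : H.rightIntegrals ≠ ⊥) : ∃ g : Module.Dual k A,
    g (H.u 1) ≠ 0 ∧ Module.Finite k (LinearMap.range (leftHit g)) := by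
  obtain ⟨T, hT, hne⟩ := Submodule.exists_mem_ne_zero_of_ne_bot h
  obtain ⟨g, hg, hfin⟩ := H.toComatrixQuasiHopf.mirror.exists_finite_range_hit_mirror
    ((H.isLeftIntegral_mirror_iff T).mpr hT) hne
  have e : H.toComatrixQuasiHopf.mirror.mirror.comul = Coalgebra.comul := by
    ext x
    exact (TensorProduct.comm k A A).symm_apply_apply (Coalgebra.comul x)
  rw [e] at hfin
  exact ⟨g, hg, hfin⟩

/-- An integral on one side gives a functional of finite rank for the other side's translation,
which in turn gives an integral on that other side. -/
theorem leftIntegrals_ne_bot_iff : H.leftIntegrals ≠ ⊥ ↔ H.rightIntegrals ≠ ⊥ := by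
  constructor <;> intro h
  · obtain ⟨g, hg, hfin⟩ := H.exists_finite_range_rightHit h
    exact H.rightIntegrals_ne_bot g (fun h0 => hg (by simp [h0])) hfin
  · obtain ⟨g, hg, hfin⟩ := H.exists_finite_range_leftHit h
    exact H.leftIntegrals_ne_bot g (fun h0 => hg (by simp [h0])) hfin

end DualQuasiHopfAlgebra

/-! ### Restriction to a subalgebra -/

section Restriction

variable {k : Type*} {A B : Type*} [Field k] [AddCommGroup A] [Module k A] [AddCommGroup B]
  [Module k B]

theorem finite_range_of_comp (ι : B →ₗ[k] A) (hι : Function.Injective ι) (p : B →ₗ[k] B)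
    (P : A →ₗ[k] A) (h : ∀ b, ι (p b) = P (ι b)) [Module.Finite k (LinearMap.range P)] :
    Module.Finite k (LinearMap.range p) := by
  let j : LinearMap.range p →ₗ[k] LinearMap.range P :=
    (ι ∘ₗ (LinearMap.range p).subtype).codRestrict _ (by
      rintro ⟨_, b, rfl⟩
      exact ⟨ι b, (h b).symm⟩)
  refine Module.Finite.of_injective j fun x y hxy => ?_
  exact Subtype.ext (hι (congrArg Subtype.val hxy))

end Restriction

end DualQuasi
end

theorem corollary4p6 {k : Type*} {A : Type*} [Field k] [AddCommGroup A] [Module k A]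
    [Coalgebra k A] (H : DualQuasi.DualQuasiHopfAlgebra k A)
    (hA : H.leftIntegrals ≠ ⊥ ∨ H.rightIntegrals ≠ ⊥)
    (B : DualQuasi.DualQuasiHopfSubalgebra H) :
    B.toDualQuasiHopfAlgebra.leftIntegrals ≠ ⊥ ∧
      B.toDualQuasiHopfAlgebra.rightIntegrals ≠ ⊥ := by
  have hL : H.leftIntegrals ≠ ⊥ := hA.elim id H.leftIntegrals_ne_bot_iff.mpr
  obtain ⟨g, hg, hgfin⟩ := H.exists_finite_range_rightHit hL
  obtain ⟨f, hf, hffin⟩ := H.exists_finite_range_leftHit (H.leftIntegrals_ne_bot_iff.mp hL)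
  -- An integral of `A` might vanish on `B`; a functional that is non-zero at `1` cannot.
  have hne : ∀ φ : Module.Dual k A, φ (H.u 1) ≠ 0 → φ ∘ₗ B.incl.toLinearMap ≠ 0 :=
    fun φ hφ h0 => hφ (LinearMap.congr_fun h0 ⟨H.u 1, B.one_mem⟩)
  have hι : Function.Injective B.incl.toLinearMap := B.toSubmodule.subtype_injective
  refine ⟨B.toDualQuasiHopfAlgebra.leftIntegrals_ne_bot _ (hne f hf) ?_,
    B.toDualQuasiHopfAlgebra.rightIntegrals_ne_bot _ (hne g hg) ?_⟩
  · exact DualQuasi.finite_range_of_comp _ hι _ _ (DualQuasi.leftHit_comp B.incl f)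
  · exact DualQuasi.finite_range_of_comp _ hι _ _ (DualQuasi.rightHit_comp B.incl g)
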